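/- Let $q$ be a complex number with $0<|q|<1$ (fractional powers of $q$ are taken with the principal branch), and put $(q)_k=\prod_{j=1}^k(1-q^j)$ for integers $k\ge 0$ and $1/(q)_k=0$ for integers $k<0$. For integers $t,b$ let $\left[{t\atop b}\right]=\frac{(q)_t}{(q)_b(q)_{t-b}}$ if $b\ge 0$ and $t-b\ge 0$, and $\left[{t\atop b}\right]=0$ otherwise. Let $N\ge 1$, let $C$ be the Cartan matrix of type $A_{N-1}$, $\mathcal I=2I-C$, let $e_1,\dots,e_{N-1}$ be the standard unit vectors of $\mathbb Z^{N-1}$ and $e_0=0$. Write $uC^{-1}v=\sum_{i,j}u_iC^{-1}_{ij}v_j$. For $N=1$ all vectors are empty, and $m_1$, $(C^{-1}n)_1$ and $(C^{-1}\eta)_{N-1}$ are read as $0$. For an integer $L\ge0$, $2a\in\{-NL,-NL+2,\dots,NL\}$ and $r\in\{0,\dots,N-1\}$ the $q$-multinomial coefficient is $$T_r^{(N)}(L,a)=\sum_{\substack{\eta\in\mathbb Z^{N-1}\\ \frac L2+\frac aN+(C^{-1}\eta)_1\in\mathbb Z}}\frac{q^{\eta C^{-1}(\eta-e_r)}\,(q)_L}{(q)_{\frac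 L2-\frac aN-(C^{-1}\eta)_1}\,(q)_{\frac L2+\frac aN-(C^{-1}\eta)_{N-1}}\,\prod_{j=1}^{N-1}(q)_{\eta_j}}.$$ Let $L\ge 0$ and $\ell$ be integers with $\ell\in\{-NL,-NL+2,\dots,NL\}$. Then $$T_0^{(N)}(L,\ell/2)=\sum_{i=0}^{\infty}q^{i(i+\ell)/N}\sum_{\substack{n\in\mathbb Z^{N-1}\\ \frac L2+\frac{2i+\ell}{2N}+(C^{-1}n)_1\in\mathbb Z}}q^{nC^{-1}n}\prod_{j=1}^{N-1}\left[{m_j+n_j\atop n_j}\right]\left[{\frac12(L+\ell+m_1)\atop i+\ell}\right]\left[{\frac12(L-\ell+m_1)\atop i}\right],$$ where $m$ is determined by $n$ and $i$ through $m+n=\frac12\bigl(\mathcal I m+(2i+\ell)e_1\bigr)$. Here, for every $n$ in the range of summation, this system has exactly one solution $m\in\mathbb Z^{N-1}$, and $\frac12(L\pm\ell+m_1)$ are integers; on both sides only finitely many terms are nonzero. For $N=1$ the left-hand side equals $\left[{L\atop (L-\ell)/2}\right]$ and the right-hand side equals $\sum_{i=0}^{(L-\ell)/2}q^{i(i+\ell)}\left[{(L+\ell)/2\atop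 i+\ell}\right]\left[{(L-\ell)/2\atop i}\right]$, so that the identity becomes the $q$-Chu–Vandermonde sum $\sum_{i=0}^{L_2}q^{i(i+\ell)}\left[{L_1\atop i+\ell}\right]\left[{L_2\atop i}\right]=\left[{L_1+L_2\atop L_1-\ell}\right]$ with $L_1=\frac12(L+\ell)$ and $L_2=\frac12(L-\ell)$. -/

import Mathlib

open scoped Matrix

noncomputable section

namespace QMult

/-- Integer vectors with `N - 1` components. The component with (one-based) number `k` is the
entry at `k - 1 : Fin (N - 1)`. -/
abbrev Vec (N : ℕ) : Type := Fin (N - 1) → ℤ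

/-- The Cartan matrix of type `A_{N-1}`. -/
def cartan (N : ℕ) : Matrix (Fin (N - 1)) (Fin (N - 1)) ℤ :=
  Matrix.of fun i j =>
    if i = j then 2 else if i.val + 1 = j.val ∨ j.val + 1 = i.val then -1 else 0

/-- The incidence matrix `2 I - C`. -/
def incidence (N : ℕ) : Matrix (Fin (N - 1)) (Fin (N - 1)) ℤ :=
  (2 : ℤ) • (1 : Matrix (Fin (N - 1)) (Fin (N - 1)) ℤ) - cartan N

/-- The inverse (over `ℚ`) of the Cartan matrix. -/
def cartanInv (N : ℕ) : Matrix (Fin (N - 1)) (Fin (N - 1)) ℚ :=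
  ((cartan N).map (fun x : ℤ => (x : ℚ)))⁻¹

/-- The standard unit vector `e_k`, `1 ≤ k ≤ N - 1`; it is `0` for all other `k`. -/
def unitVec (N k : ℕ) : Vec N := fun j => if j.val + 1 = k then 1 else 0

/-- The bilinear form `u C⁻¹ v`. In particular `(C⁻¹ v)_k = e_k C⁻¹ v`. -/
def form (N : ℕ) (u v : Vec N) : ℚ :=
  (fun j => (u j : ℚ)) ⬝ᵥ (cartanInv N *ᵥ fun j => (v j : ℚ))

/-- The component `v_k = e_k · v`; for `N = 1` it is `0`. -/
def comp (N k : ℕ) (v : Vec N) : ℤ := unitVec N k ⬝ᵥ v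

/-- The `q`-shifted factorial `(q)_k = (q; q)_k` for `k ≥ 0`. -/
def qPoch (q : ℂ) (k : ℕ) : ℂ := ∏ j ∈ Finset.range k, (1 - q ^ (j + 1))

/-- The reciprocal `1 / (q)_k` for an integer `k`; it vanishes for negative `k`. -/
def qPochInv (q : ℂ) (k : ℤ) : ℂ := if k < 0 then 0 else (qPoch q k.toNat)⁻¹

/-- The `q`-binomial coefficient with top `t` and bottom `b`: it is `(q)_t / ((q)_b (q)_{t-b})`
if `b ≥ 0` and `t - b ≥ 0`, and `0` otherwise. -/
def qBin (q : ℂ) (t b : ℤ) : ℂ :=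
  if 0 ≤ b ∧ 0 ≤ t - b then
    qPoch q t.toNat / (qPoch q b.toNat * qPoch q (t - b).toNat)
  else 0

/-- The range of summation in the `q`-multinomial coefficient:
`L / 2 + a / N + (C⁻¹ η)_1` is an integer. -/
def multIndex (N L : ℕ) (a : ℚ) : Set (Vec N) :=
  {η | ∃ z : ℤ, (L : ℚ) / 2 + a / N + form N (unitVec N 1) η = z}

/-- The summand of the `q`-multinomial coefficient. When `2 a` is an integer congruent to `N L`
modulo `2` and `η` lies in `multIndex N L a`, the two numbers under `⌊ ⌋` are integers, so that
`⌊ ⌋` is only a coercion to `ℤ`. -/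
def multTerm (q : ℂ) (N n L : ℕ) (a : ℚ) (η : Vec N) : ℂ :=
  q ^ ((form N η (η - unitVec N n) : ℚ) : ℂ) * qPoch q L
    * qPochInv q ⌊(L : ℚ) / 2 - a / N - form N (unitVec N 1) η⌋
    * qPochInv q ⌊(L : ℚ) / 2 + a / N - form N (unitVec N (N - 1)) η⌋
    * ∏ j, qPochInv q (η j)

/-- The `q`-multinomial coefficient `T_n^{(N)}(L, a)`. -/
def T (q : ℂ) (N n L : ℕ) (a : ℚ) : ℂ := ∑ᶠ η ∈ multIndex N L a, multTerm q N n L a η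

/-- The range of summation for `n`:
`L / 2 + (2 i + ℓ) / (2 N) + (C⁻¹ n)_1` is an integer. -/
def nIndex (N L : ℕ) (l : ℤ) (i : ℕ) : Set (Vec N) :=
  {n | ∃ z : ℤ, (L : ℚ) / 2 + (2 * i + l) / (2 * N) + form N (unitVec N 1) n = z}

/-- The `(m, n)`-system `m + n = (1/2) (𝓘 m + (2 i + ℓ) e_1)`, with the factor `1/2` cleared. -/
def mnSystem (N : ℕ) (l : ℤ) (i : ℕ) (m n : Vec N) : Prop :=
  (2 : ℤ) • (m + n) = incidence N *ᵥ m + (2 * (i : ℤ) + l) • unitVec N 1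

/-- The pairs `(m, n)` for which `n` is in the range of summation and `m` is given by the
`(m, n)`-system. -/
def mnIndex (N L : ℕ) (l : ℤ) (i : ℕ) : Set (Vec N × Vec N) :=
  {p | p.2 ∈ nIndex N L l i ∧ mnSystem N l i p.1 p.2}

/-- The summand for given `i` and `(m, n)`, without the factor `q ^ (i (i + ℓ) / N)`. For
`(m, n)` in `mnIndex N L l i` the two numerators that are divided by `2` are even. -/
def decompTerm (q : ℂ) (N L : ℕ) (l : ℤ) (i : ℕ) (m n : Vec N) : ℂ :=
  q ^ ((form N n n : ℚ) : ℂ) * (∏ j, qBin q (m j + n j) (n j))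
    * qBin q ((L + l + comp N 1 m) / 2) (i + l)
    * qBin q ((L - l + comp N 1 m) / 2) i

/-- The double sum over `i ≥ 0` and over `n`, with `m` determined by `n`. -/
def decompSum (q : ℂ) (N L : ℕ) (l : ℤ) : ℂ :=
  ∑ᶠ i : ℕ, q ^ ((((i : ℚ) * (i + l) / N : ℚ)) : ℂ)
    * ∑ᶠ p ∈ mnIndex N L l i, decompTerm q N L l i p.1 p.2

end QMult

end

/-! Put A = (NL + ℓ)/2 and A' = NL - A. Up to explicit powers of q, the left side is the nested sum
of q^{P₁² + ⋯ + P_N²} [L; P₁] [P₁; P₂] ⋯ over P₁ + ⋯ + P_N = A (`T_eq_nestedSum`), where P_j counts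
the parts of size at least j. The right side is a fermionic sum over string multiplicities ν₁, …,
ν_N for L sites of size N (`decompSum_eq_fermSum`): i = A' - ∑ a ν_a, the vector n consists of the
ν_a with a < N, m of the vacancy numbers, both in reversed order, and the two last binomials carry
ν_N. Both translations rest on C⁻¹_{ij} = min(i, j) - ij/N.

The two sums are compared through a third object, `partSeq`: apply to 1, for each part c of a list,
a q-difference operator which at q = 1 is multiplication by the sl₂ character of dimension c + 1.
For L parts of size N the result is q^{-LA} times the nested sum (`partSeq_replicate`), since the
nested sum obeys the two-term recursion `nestedSum_rec`.

Fermionic sums and operator sequences share a q-deformed Clebsch–Gordan rule: a pair (a, b) is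
traded for (a + 1, b - 1) plus a single part a - b (`fermSum_pair`, `partSeq_append_pair`). On the
fermionic side its source is the q-Pascal rule applied to one string length (`fermSum_rec`). The
rule builds up parts of the largest size from smaller ones; once no part of the largest size is
left, the q-Pfaff–Saalschütz sum merges the two longest string lengths and lowers the rank
(`fermSum_snoc_zero`). Rank one is q-Chu–Vandermonde (`fermSum_one`). The induction is
`fermSum_eq_partSeq`, and `fermSum_top` is the case that is needed. -/

noncomputable section

namespace QMult

/-! ### q-factorials and q-binomial coefficients. -/

lemma one_sub_pow_ne_zero {q : ℂ} (hq1 : ‖q‖ < 1) (k : ℕ) : (1 - q ^ (k + 1) : ℂ) ≠ 0 := by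
  intro h
  have h1 : q ^ (k + 1) = 1 := (sub_eq_zero.mp h).symm
  have h2 : ‖q‖ ^ (k + 1) = 1 := by rw [← norm_pow, h1, norm_one]
  have h3 : ‖q‖ ^ (k + 1) < 1 := pow_lt_one₀ (norm_nonneg _) hq1 (by omega)
  linarith

lemma qPoch_ne_zero {q : ℂ} (hq1 : ‖q‖ < 1) (k : ℕ) : qPoch q k ≠ 0 :=
  Finset.prod_ne_zero_iff.mpr fun j _ => one_sub_pow_ne_zero hq1 j

lemma qPoch_toNat_succ (q : ℂ) {t : ℤ} (ht : 0 ≤ t) :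
    qPoch q (t + 1).toNat = (1 - q ^ (t + 1)) * qPoch q t.toNat := by
  lift t to ℕ using ht
  have : ((t : ℤ) + 1).toNat = t + 1 := by omega
  rw [this, Int.toNat_natCast, qPoch, Finset.prod_range_succ, mul_comm]
  norm_cast

lemma qPochInv_of_neg (q : ℂ) {k : ℤ} (hk : k < 0) : qPochInv q k = 0 := by simp [qPochInv, hk]

lemma qPochInv_of_nonneg (q : ℂ) {k : ℤ} (hk : 0 ≤ k) :
    qPochInv q k = (qPoch q k.toNat)⁻¹ := by simp [qPochInv, not_lt.mpr hk]

lemma qPochInv_sub_one {q : ℂ} (hq1 : ‖q‖ < 1) (k : ℤ) :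
    qPochInv q (k - 1) = (1 - q ^ k) * qPochInv q k := by
  rcases lt_trichotomy k 0 with hk | rfl | hk
  · rw [qPochInv_of_neg _ hk, qPochInv_of_neg _ (by omega), mul_zero]
  · simp [qPochInv]
  · rw [qPochInv_of_nonneg _ hk.le, qPochInv_of_nonneg _ (by omega)]
    have h := qPoch_toNat_succ q (t := k - 1) (by omega)
    rw [sub_add_cancel] at h
    have h1 := qPoch_ne_zero hq1 k.toNat
    have h2 := qPoch_ne_zero hq1 (k - 1).toNat
    rw [h] at h1 ⊢
    have h3 := left_ne_zero_of_mul h1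
    field_simp

lemma qBin_eq (q : ℂ) (t b : ℤ) :
    qBin q t b = qPoch q t.toNat * qPochInv q b * qPochInv q (t - b) := by
  unfold qBin
  split_ifs with h
  · rw [qPochInv_of_nonneg _ h.1, qPochInv_of_nonneg _ h.2, div_eq_mul_inv, mul_inv, mul_assoc]
  · rw [not_and_or, not_le, not_le] at h
    rcases h with h | h <;> simp [qPochInv_of_neg _ h]

lemma qBin_eq_zero_of_neg (q : ℂ) {t b : ℤ} (h : b < 0) : qBin q t b = 0 :=
  if_neg (by omega)

lemma qBin_eq_zero_of_lt (q : ℂ) {t b : ℤ} (h : t < b) : qBin q t b = 0 :=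
  if_neg (by omega)

lemma qBin_zero_right {q : ℂ} (hq1 : ‖q‖ < 1) {t : ℤ} (h : 0 ≤ t) : qBin q t 0 = 1 := by
  have := qPoch_ne_zero hq1 t.toNat
  simp [qBin, h, qPoch] at this ⊢
  exact this

lemma qBin_self {q : ℂ} (hq1 : ‖q‖ < 1) {t : ℤ} (h : 0 ≤ t) : qBin q t t = 1 := by
  have := qPoch_ne_zero hq1 t.toNat
  simp [qBin, h, qPoch] at this ⊢
  exact this

lemma qBin_symm (q : ℂ) (t b : ℤ) : qBin q t (t - b) = qBin q t b := by
  rw [qBin_eq, qBin_eq, sub_sub_cancel]; ring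

/-- The case t = b = 0 must be excluded: the left side is 1, while both binomials with top -1 vanish
by convention. For every other t ≤ 0 all three terms are zero. This exception is what makes
`fermTerm_rec` delicate. -/
lemma qBin_pascal {q : ℂ} (hq0 : q ≠ 0) (hq1 : ‖q‖ < 1) {t b : ℤ} (h : ¬ (t = 0 ∧ b = 0)) :
    qBin q t b = q ^ b * qBin q (t - 1) b + qBin q (t - 1) (b - 1) := by
  rcases lt_or_ge 0 t with ht | ht
  · have h1 := qPoch_toNat_succ q (t := t - 1) (by omega)
    rw [sub_add_cancel] at h1
    have h2 := qPochInv_sub_one hq1 b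
    have h3 := qPochInv_sub_one hq1 (t - b)
    rw [qBin_eq, qBin_eq, qBin_eq, h1, h2, show t - 1 - b = t - b - 1 by ring, h3,
      show t - 1 - (b - 1) = t - b by ring]
    have h4 : q ^ b * q ^ (t - b) = q ^ t := by rw [← zpow_add₀ hq0]; congr 1; ring
    linear_combination (-1 : ℂ) * qPoch q (t - 1).toNat * qPochInv q b * qPochInv q (t - b) * (- h4)
  · rw [qBin, qBin, qBin, if_neg (by omega), if_neg (by omega), if_neg (by omega)]; ring

lemma qBin_pascal' {q : ℂ} (hq0 : q ≠ 0) (hq1 : ‖q‖ < 1) {t b : ℤ} (h : ¬ (t = 0 ∧ b = 0)) :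
    qBin q t b = qBin q (t - 1) b + q ^ (t - b) * qBin q (t - 1) (b - 1) := by
  rw [← qBin_symm, qBin_pascal hq0 hq1 (by omega), ← qBin_symm q (t - 1) b,
    ← qBin_symm q (t - 1) (b - 1), show t - 1 - (b - 1) = t - b by ring,
    show t - 1 - b = t - b - 1 by ring]
  ring

/-! ### The q-Chu–Vandermonde and q-Pfaff–Saalschütz sums. -/

/-- The `q`-Chu–Vandermonde sum. -/
lemma q_chu_vandermonde {q : ℂ} (hq0 : q ≠ 0) (hq1 : ‖q‖ < 1) {m : ℤ} (hm : 0 ≤ m) (n : ℕ) :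
    ∀ k : ℤ, ∑ j ∈ Finset.Icc 0 m, q ^ ((m - j) * (k - j)) * qBin q m j * qBin q n (k - j)
      = qBin q (m + n) k := by
  induction n with
  | zero =>
    intro k
    have h0 : ∀ c : ℤ, qBin q ((0 : ℕ) : ℤ) c = if c = 0 then 1 else 0 := by
      intro c
      split_ifs with h
      · subst h; exact qBin_zero_right hq1 le_rfl
      · exact if_neg (by push_cast; omega)
    have h1 : ∀ j ∈ Finset.Icc 0 m, q ^ ((m - j) * (k - j)) * qBin q m j
        * qBin q ((0 : ℕ) : ℤ) (k - j) = if j = k then qBin q m k else 0 := by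
      intro j _
      rw [h0]
      split_ifs with h2 h3 h3
      · subst h3; simp
      · omega
      · omega
      · ring
    rw [Finset.sum_congr rfl h1, Finset.sum_ite_eq']
    simp only [Nat.cast_zero, add_zero]
    split_ifs with h
    · rfl
    · rw [Finset.mem_Icc] at h
      exact (if_neg (by omega)).symm
  | succ n ih =>
    intro k
    push_cast
    rw [qBin_pascal' hq0 hq1 (t := m + (n + 1)) (by omega), show m + ((n : ℤ) + 1) - 1 = m + n by ring,
      ← ih k, ← ih (k - 1), Finset.mul_sum, ← Finset.sum_add_distrib]
    refine Finset.sum_congr rfl fun j _ => ?_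
    rw [qBin_pascal' hq0 hq1 (t := (n : ℤ) + 1) (by omega), show (n : ℤ) + 1 - 1 = n by ring,
      show k - j - 1 = k - 1 - j by ring]
    have : q ^ ((m - j) * (k - j)) * q ^ ((n : ℤ) + 1 - (k - j))
        = q ^ (m + (n + 1) - k) * q ^ ((m - j) * (k - 1 - j)) := by
      rw [← zpow_add₀ hq0, ← zpow_add₀ hq0]; congr 1; ring
    linear_combination qBin q m j * qBin q n (k - 1 - j) * this

/-- A WZ-type certificate: the combination of the summands for I + 1 and I that should sum to zero
is the difference G(S + 1) - G(S) of an explicit G. Writing everything with reciprocals 1/(q)_k that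
vanish for k < 0 makes the boundary values of G vanish without case distinctions. -/
lemma q_saalschuetz_step {q : ℂ} (hq0 : q ≠ 0) (hq1 : ‖q‖ < 1) (I J T S : ℕ) (hS : S ≤ T) :
    (1 - q ^ ((I : ℤ) + 1)) * (q ^ ((S : ℤ) ^ 2) * qBin q ((I + 1) + J + T - S) (T - S)
        * qBin q J S * qBin q (I + 1) S)
      - (1 - q ^ ((T : ℤ) + I + 1)) * (q ^ ((S : ℤ) ^ 2) * qBin q (I + J + T - S) (T - S)
        * qBin q J S * qBin q I S)
    = (fun S : ℕ => -(q ^ ((I : ℤ) + 1) * qPochInv q (I + J + 1) * qPoch q J * qPoch q I)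
        * q ^ ((S : ℤ) ^ 2 - S) * qPoch q ((I : ℤ) + J + T - S + 1).toNat * qPochInv q (T - S)
        * qPochInv q (S - 1) ^ 2 * qPochInv q (J - S) * qPochInv q (I + 1 - S)) (S + 1)
      - (fun S : ℕ => -(q ^ ((I : ℤ) + 1) * qPochInv q (I + J + 1) * qPoch q J * qPoch q I)
        * q ^ ((S : ℤ) ^ 2 - S) * qPoch q ((I : ℤ) + J + T - S + 1).toNat * qPochInv q (T - S)
        * qPochInv q (S - 1) ^ 2 * qPochInv q (J - S) * qPochInv q (I + 1 - S)) S := by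
  have hn : qPoch q ((I : ℤ) + J + T - S + 1).toNat
      = (1 - q ^ ((I : ℤ) + J + T - S + 1)) * qPoch q ((I : ℤ) + J + T - S).toNat :=
    qPoch_toNat_succ q (by omega)
  have hI : qPoch q ((I : ℤ) + 1).toNat = (1 - q ^ ((I : ℤ) + 1)) * qPoch q I := by
    simpa using qPoch_toNat_succ q (t := I) (by omega)
  have e1 := qPochInv_sub_one hq1 ((I : ℤ) + J + 1)
  have e2 := qPochInv_sub_one hq1 ((I : ℤ) + 1 - S)
  have e3 := qPochInv_sub_one hq1 ((T : ℤ) - S)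
  have e4 := qPochInv_sub_one hq1 ((J : ℤ) - S)
  have e5 := qPochInv_sub_one hq1 (S : ℤ)
  simp only [qBin_eq]
  push_cast
  rw [show (I : ℤ) + 1 + J + T - S = I + J + T - S + 1 by ring,
    show (I : ℤ) + J + T - S + 1 - (T - S) = I + J + 1 by ring,
    show (I : ℤ) + J + T - S - (T - S) = I + J + 1 - 1 by ring,
    show (I : ℤ) - S = I + 1 - S - 1 by ring, show (T : ℤ) - (S + 1) = T - S - 1 by ring,
    show (J : ℤ) - (S + 1) = J - S - 1 by ring, show (I : ℤ) + 1 - (S + 1) = I + 1 - S - 1 by ring,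
    show (I : ℤ) + J + T - (S + 1) + 1 = I + J + T - S by ring,
    show (S : ℤ) + 1 - 1 = S by ring, show ((S : ℤ) + 1) ^ 2 - (S + 1) = S ^ 2 + S by ring,
    e1, e2, e3, e4, e5, hn, hI, Int.toNat_natCast, Int.toNat_natCast]
  have z0 : q ^ (S : ℤ) ≠ 0 := zpow_ne_zero _ hq0
  simp only [zpow_sub₀ hq0, zpow_add₀ hq0, zpow_one]
  field_simp
  ring

/-- The `q`-Pfaff–Saalschütz sum. -/
lemma q_saalschuetz {q : ℂ} (hq0 : q ≠ 0) (hq1 : ‖q‖ < 1) (I J T : ℕ) :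
    ∑ S ∈ Finset.range (T + 1), q ^ ((S : ℤ) ^ 2) * qBin q (I + J + T - S) (T - S)
        * qBin q J S * qBin q I S = qBin q (T + J) T * qBin q (T + I) T := by
  induction I with
  | zero =>
    rw [Finset.sum_eq_single_of_mem 0 (by simp)]
    · simp only [Nat.cast_zero, sub_zero, zero_add, add_zero]
      rw [qBin_zero_right hq1 (by omega), qBin_zero_right hq1 le_rfl, qBin_self hq1 (by omega),
        add_comm]
      simp
    · intro S _ hS
      rw [qBin_eq_zero_of_lt q (t := ((0 : ℕ) : ℤ)) (by omega), mul_zero]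
  | succ I ih =>
    have h0 : (1 - q ^ ((I : ℤ) + 1)) ≠ 0 := by
      exact_mod_cast one_sub_pow_ne_zero hq1 I
    apply mul_left_cancel₀ h0
    -- The product side satisfies the same first-order recursion in I as the sum.
    have h1 : (1 - q ^ ((I : ℤ) + 1)) * qBin q (T + ((I + 1 : ℕ) : ℤ)) T
        = (1 - q ^ ((T : ℤ) + I + 1)) * qBin q (T + I) T := by
      have a1 := qPoch_toNat_succ q (t := (T : ℤ) + I) (by omega)
      have a2 := qPochInv_sub_one hq1 ((I : ℤ) + 1)
      rw [add_sub_cancel_right] at a2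
      rw [qBin_eq, qBin_eq]
      push_cast
      rw [← add_assoc, a1, show (T : ℤ) + I + 1 - T = I + 1 by ring,
        show (T : ℤ) + I - T = I by ring, a2]
      ring
    have h2 := Finset.sum_range_sub (fun S : ℕ =>
        -(q ^ ((I : ℤ) + 1) * qPochInv q (I + J + 1) * qPoch q J * qPoch q I)
        * q ^ ((S : ℤ) ^ 2 - S) * qPoch q ((I : ℤ) + J + T - S + 1).toNat * qPochInv q (T - S)
        * qPochInv q (S - 1) ^ 2 * qPochInv q (J - S) * qPochInv q (I + 1 - S)) (T + 1)
    rw [← Finset.sum_congr rfl fun S hS => q_saalschuetz_step hq0 hq1 I J T S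
      (by simpa [Nat.lt_succ_iff] using hS), Finset.sum_sub_distrib, ← Finset.mul_sum,
      ← Finset.mul_sum, ih] at h2
    -- The telescoped sum is G(T + 1) - G(0); each end contains the factor 1/(q)_{-1} = 0.
    have h3 : qPochInv q ((T : ℤ) - ((T + 1 : ℕ) : ℤ)) = 0 := qPochInv_of_neg q (by push_cast; omega)
    have h4 : qPochInv q (((0 : ℕ) : ℤ) - 1) = 0 := qPochInv_of_neg q (by omega)
    rw [h3, h4] at h2
    push_cast at h1 h2 ⊢
    linear_combination h2 - qBin q (T + J) T * h1

/-! ### Difference operators that adjoin a part. -/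

/-- Multiplication of a power series by 1 - x is injective. Comparing first differences thus removes
the division by x - x⁻¹ in `adjoinPart`, whose coefficient form is a partial sum. -/
lemma eq_of_sub_eq {f g : ℤ → ℂ} (h0 : ∀ A < 0, f A = g A)
    (h : ∀ A, f A - f (A - 1) = g A - g (A - 1)) (A : ℤ) : f A = g A := by
  rcases lt_or_ge A 0 with hA | hA
  · exact h0 A hA
  · induction A, hA using Int.leInduction with
    | base =>
      have := h 0
      rw [h0 (0 - 1) (by omega)] at this
      linear_combination this
    | succ A hA ih =>
      have := h (A + 1)
      rw [add_sub_cancel_right, ih] at this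
      linear_combination this

/-- The operator that adjoins a part `c` to a sequence of total size `K`; it is the coefficient form
of the difference operator `(x^{c+1} τ - x^{-c-1} τ⁻¹) / (x - x⁻¹)` with `τ x = q^{1/2} x τ`. -/
def adjoinPart (q : ℂ) (c : ℕ) (K : ℤ) (φ : ℤ → ℂ) (A : ℤ) : ℂ :=
  ∑ B ∈ Finset.Icc 0 A, (q ^ (-B) * φ B - q ^ (B - c - 1 - K) * φ (B - c - 1))

lemma adjoinPart_of_neg (q : ℂ) (c : ℕ) (K : ℤ) (φ : ℤ → ℂ) {A : ℤ} (hA : A < 0) :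
    adjoinPart q c K φ A = 0 := by
  rw [adjoinPart, Finset.Icc_eq_empty (by omega), Finset.sum_empty]

lemma adjoinPart_sub (q : ℂ) (c : ℕ) (K : ℤ) {φ : ℤ → ℂ} (hφ : ∀ A < 0, φ A = 0) (A : ℤ) :
    adjoinPart q c K φ A - adjoinPart q c K φ (A - 1)
      = q ^ (-A) * φ A - q ^ (A - c - 1 - K) * φ (A - c - 1) := by
  rcases lt_or_ge A 0 with hA | hA
  · rw [adjoinPart_of_neg _ _ _ _ hA, adjoinPart_of_neg _ _ _ _ (by omega), hφ A hA,
      hφ _ (by omega)]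
    ring
  · have : Finset.Icc 0 A = insert A (Finset.Icc 0 (A - 1)) := by
      ext x; simp only [Finset.mem_Icc, Finset.mem_insert]; omega
    rw [adjoinPart, adjoinPart, this, Finset.sum_insert (by simp)]
    ring

lemma adjoinPart_succ {q : ℂ} (c : ℕ) (K : ℤ) {φ : ℤ → ℂ}
    (hφ : ∀ A < 0, φ A = 0) (A : ℤ) :
    adjoinPart q (c + 1) K φ A
      = adjoinPart q c K φ A + q ^ (A - c - 1 - K) * φ (A - c - 1) := by
  refine eq_of_sub_eq (f := adjoinPart q (c + 1) K φ)
    (g := fun A => adjoinPart q c K φ A + q ^ (A - c - 1 - K) * φ (A - c - 1)) ?_ ?_ A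
  · intro A hA
    rw [adjoinPart_of_neg _ _ _ _ hA, adjoinPart_of_neg _ _ _ _ hA, hφ _ (by omega)]
    ring
  · intro A
    have h1 := adjoinPart_sub q (c + 1) K hφ A
    have h2 := adjoinPart_sub q c K hφ A
    push_cast at h1
    rw [show A - (c + 1) - 1 - K = A - 1 - c - 1 - K by ring,
      show A - ((c : ℤ) + 1) - 1 = A - 1 - c - 1 by ring] at h1
    linear_combination h1 - h2

/-- After taking first differences the two sides carry the same power of q in their second terms.
Replacing the operator for c + 1 by the one for c with `adjoinPart_succ` leaves exactly the
difference formula of the operator for c at A - c - 1. -/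
lemma adjoinPart_comm {q : ℂ} (hq0 : q ≠ 0) (c : ℕ) (K : ℤ) {φ : ℤ → ℂ}
    (hφ : ∀ A < 0, φ A = 0) (A : ℤ) :
    adjoinPart q (c + 1) (c + K) (adjoinPart q c K φ) A
      = adjoinPart q c (c + 1 + K) (adjoinPart q (c + 1) K φ) A := by
  refine eq_of_sub_eq (fun A hA => ?_) (fun A => ?_) A
  · rw [adjoinPart_of_neg _ _ _ _ hA, adjoinPart_of_neg _ _ _ _ hA]
  · rw [adjoinPart_sub _ _ _ fun A hA => adjoinPart_of_neg _ _ _ _ hA,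
      adjoinPart_sub _ _ _ fun A hA => adjoinPart_of_neg _ _ _ _ hA]
    have h1 := adjoinPart_succ (q := q) c K hφ A
    have h2 := adjoinPart_succ (q := q) c K hφ (A - c - 1)
    have h3 := adjoinPart_sub q c K hφ (A - c - 1)
    rw [h1, h2]
    push_cast
    rw [show A - (c + 1) - 1 - (c + K) = A - c - 1 - (c + 1 + K) by ring,
      show A - ((c : ℤ) + 1) - 1 = A - c - 1 - 1 by ring]
    have e1 : q ^ (-A) * q ^ (A - c - 1 - K)
        = q ^ (A - c - 1 - (c + 1 + K)) * q ^ (-(A - c - 1)) := by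
      rw [← zpow_add₀ hq0, ← zpow_add₀ hq0]; congr 1; ring
    linear_combination q ^ (A - c - 1 - (c + 1 + K)) * h3 - φ (A - c - 1) * e1

lemma adjoinPart_add_mul (q : ℂ) (c : ℕ) (K : ℤ) (φ ψ : ℤ → ℂ) (x : ℂ) (A : ℤ) :
    adjoinPart q c K (fun B => φ B + x * ψ B) A
      = adjoinPart q c K φ A + x * adjoinPart q c K ψ A := by
  rw [adjoinPart, adjoinPart, adjoinPart, Finset.mul_sum, ← Finset.sum_add_distrib]
  exact Finset.sum_congr rfl fun B _ => by ring

/-- Shifting A by b and K by 2b describes the same Laurent polynomial. The factor q^{-b} comes from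
the normalisation: `adjoinPart` is the difference operator times q^{-K/2}. -/
lemma adjoinPart_shift {q : ℂ} (hq0 : q ≠ 0) (c b : ℕ) (K : ℤ) {φ : ℤ → ℂ}
    (hφ : ∀ A < 0, φ A = 0) (A : ℤ) :
    adjoinPart q c (K + 2 * b) (fun B => φ (B - b)) A
      = q ^ (-(b : ℤ)) * adjoinPart q c K φ (A - b) := by
  refine eq_of_sub_eq (f := adjoinPart q c (K + 2 * b) fun B => φ (B - b))
    (g := fun A => q ^ (-(b : ℤ)) * adjoinPart q c K φ (A - b)) (fun A hA => ?_) (fun A => ?_) A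
  · rw [adjoinPart_of_neg _ _ _ _ hA, adjoinPart_of_neg _ _ _ _ (by omega), mul_zero]
  · rw [adjoinPart_sub _ _ _ fun A hA => hφ _ (by omega)]
    have h := adjoinPart_sub q c K hφ (A - b)
    rw [show A - 1 - (b : ℤ) = A - b - 1 by ring, show A - c - 1 - (b : ℤ) = A - b - c - 1 by ring]
    have e1 : q ^ (-A) = q ^ (-(b : ℤ)) * q ^ (-(A - b)) := by
      rw [← zpow_add₀ hq0]; congr 1; ring
    have e2 : q ^ (A - c - 1 - (K + 2 * b)) = q ^ (-(b : ℤ)) * q ^ (A - b - c - 1 - K) := by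
      rw [← zpow_add₀ hq0]; congr 1; ring
    rw [e1, e2]
    linear_combination (-1 : ℂ) * q ^ (-(b : ℤ)) * h

/-- The coefficients of the Laurent polynomial obtained from `1` by adjoining the parts of a list,
the last one first. -/
def partSeq (q : ℂ) : List ℕ → ℤ → ℂ
  | [] => fun A => if A = 0 then 1 else 0
  | c :: r => adjoinPart q c (r.sum : ℕ) (partSeq q r)

lemma partSeq_of_neg (q : ℂ) (r : List ℕ) : ∀ A < 0, partSeq q r A = 0 := by
  intro A hA
  cases r with
  | nil => exact if_neg hA.ne
  | cons c r => exact adjoinPart_of_neg _ _ _ _ hA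

lemma partSeq_append_congr {q : ℂ} (Λ : List ℕ) {r r' : List ℕ} (hs : r.sum = r'.sum)
    (h : partSeq q r = partSeq q r') : partSeq q (Λ ++ r) = partSeq q (Λ ++ r') := by
  induction Λ with
  | nil => exact h
  | cons c Λ ih => simp only [List.cons_append, partSeq, ih, List.sum_append, hs]

lemma partSeq_comm {q : ℂ} (hq0 : q ≠ 0) (c : ℕ) (r : List ℕ) :
    partSeq q ((c + 1) :: c :: r) = partSeq q (c :: (c + 1) :: r) := by
  funext A
  have := adjoinPart_comm hq0 c (r.sum : ℕ) (partSeq_of_neg q r) A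
  simpa only [partSeq, List.sum_cons, Nat.cast_add, Nat.cast_one] using this

lemma partSeq_cons_replicate {q : ℂ} (hq0 : q ≠ 0) (c k : ℕ) (r : List ℕ) :
    partSeq q ((c + 1) :: (List.replicate k c ++ r))
      = partSeq q (List.replicate k c ++ (c + 1) :: r) := by
  induction k with
  | zero => rfl
  | succ k ih =>
    rw [List.replicate_succ, List.cons_append, partSeq_comm hq0]
    refine partSeq_append_congr [c] ?_ ih
    simp; ring

lemma partSeq_singleton {q : ℂ} (b : ℕ) (A : ℤ) :
    partSeq q [b] A = if 0 ≤ A ∧ A ≤ b then 1 else 0 := by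
  refine eq_of_sub_eq (f := partSeq q [b]) (g := fun A => if 0 ≤ A ∧ A ≤ b then 1 else 0)
    (fun A hA => ?_) (fun A => ?_) A
  · rw [partSeq_of_neg _ _ _ hA]; exact (if_neg (by omega)).symm
  · have h := adjoinPart_sub q b (([] : List ℕ).sum : ℕ) (partSeq_of_neg q []) A
    rw [show partSeq q [b] = adjoinPart q b (([] : List ℕ).sum : ℕ) (partSeq q []) from rfl, h]
    simp only [partSeq]
    rcases eq_or_ne A 0 with rfl | h1
    · rw [if_pos rfl, if_neg (by omega), if_pos (by omega), if_neg (by omega)]; simp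
    rcases eq_or_ne A (b + 1) with rfl | h2
    · rw [if_neg (by omega), if_pos (by omega), if_neg (by omega), if_pos (by omega)]; simp
    · rw [if_neg (by omega), if_neg (by omega)]
      by_cases h3 : 0 ≤ A ∧ A ≤ b
      · rw [if_pos h3, if_pos (by omega)]; simp
      · rw [if_neg h3, if_neg (by omega)]; simp

/-- A q-analogue of the character identity χ_a χ_{b+1} = χ_{a+1} χ_b + χ_{a-b-1} of sl₂. Single
parts have coefficients 0 and 1, so the first differences of the two pairs differ only by indicator
terms at A = b + 1 and A = a + 1. -/
lemma partSeq_pair {q : ℂ} {a b : ℕ} (hab : b + 1 ≤ a) (A : ℤ) :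
    partSeq q [a, b + 1] A = partSeq q [a + 1, b] A
      + q ^ (-((b : ℤ) + 1)) * partSeq q [a - (b + 1)] (A - (b + 1)) := by
  refine eq_of_sub_eq (f := partSeq q [a, b + 1]) (g := fun A => partSeq q [a + 1, b] A
      + q ^ (-((b : ℤ) + 1)) * partSeq q [a - (b + 1)] (A - (b + 1))) (fun A hA => ?_)
      (fun A => ?_) A
  · rw [partSeq_of_neg _ _ _ hA, partSeq_of_neg _ _ _ hA, partSeq_of_neg _ _ _ (by omega)]; ring
  · have h1 := adjoinPart_sub q a ([b + 1].sum : ℕ) (partSeq_of_neg q [b + 1]) A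
    have h2 := adjoinPart_sub q (a + 1) ([b].sum : ℕ) (partSeq_of_neg q [b]) A
    have d1 : partSeq q [a, b + 1] = adjoinPart q a ([b + 1].sum : ℕ) (partSeq q [b + 1]) := rfl
    have d2 : partSeq q [a + 1, b] = adjoinPart q (a + 1) ([b].sum : ℕ) (partSeq q [b]) := rfl
    rw [← d1] at h1
    rw [← d2] at h2
    have c1 : partSeq q [b + 1] A = partSeq q [b] A + if A = b + 1 then 1 else 0 := by
      simp only [partSeq_singleton]; push_cast
      by_cases h : A = b + 1
      · rw [if_pos (by omega), if_neg (by omega), if_pos h]; simp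
      · by_cases h' : 0 ≤ A ∧ A ≤ b
        · rw [if_pos (by omega), if_pos h', if_neg h]; simp
        · rw [if_neg (by omega), if_neg h', if_neg h]; simp
    have c2 : partSeq q [b + 1] (A - a - 1)
        = partSeq q [b] (A - (a + 1 : ℕ) - 1) + if A = a + 1 then 1 else 0 := by
      simp only [partSeq_singleton]; push_cast
      by_cases h : A = a + 1
      · rw [if_pos (by omega), if_neg (by omega), if_pos h]; simp
      · by_cases h' : 0 ≤ A - (a + 1) - 1 ∧ A - (a + 1) - 1 ≤ b
        · rw [if_pos (by omega), if_pos h', if_neg h]; simp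
        · rw [if_neg (by omega), if_neg h', if_neg h]; simp
    have c3 : partSeq q [a - (b + 1)] (A - (b + 1)) + (if A = a + 1 then 1 else 0)
        = partSeq q [a - (b + 1)] (A - 1 - (b + 1)) + if A = b + 1 then 1 else 0 := by
      simp only [partSeq_singleton]; push_cast [hab]
      by_cases h : A = b + 1
      · rw [if_pos (by omega), if_neg (by omega), if_neg (by omega), if_pos h]; simp
      by_cases h3 : A = a + 1
      · rw [if_neg (by omega), if_pos h3, if_pos (by omega), if_neg h]; simp
      · by_cases h' : 0 ≤ A - ((b : ℤ) + 1) ∧ A - ((b : ℤ) + 1) ≤ a - (b + 1)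
        · rw [if_pos h', if_neg h3, if_pos (by omega), if_neg h]
        · rw [if_neg h', if_neg h3, if_neg (by omega), if_neg h]
    have c4 : q ^ (-A) * (if A = b + 1 then 1 else 0 : ℂ)
        = q ^ (-((b : ℤ) + 1)) * if A = b + 1 then 1 else 0 := by
      split_ifs with h
      · rw [h]
      · simp
    have c5 : q ^ (A - a - 1 - ([b + 1].sum : ℕ)) * (if A = a + 1 then 1 else 0 : ℂ)
        = q ^ (-((b : ℤ) + 1)) * if A = a + 1 then 1 else 0 := by
      split_ifs with h
      · rw [h]; congr 2; simp
      · simp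
    have c6 : A - a - 1 - ([b + 1].sum : ℕ) = A - (a + 1 : ℕ) - 1 - ([b].sum : ℕ) := by
      simp; ring
    rw [c1, c2] at h1
    rw [← c6] at h2
    linear_combination h1 - h2 + c4 - c5 - q ^ (-((b : ℤ) + 1)) * c3

/-- Passing to the single part a - (b + 1) lowers the total size by 2(b + 1), so by
`adjoinPart_shift` each operator of Λ contributes a further factor q^{-(b+1)}. -/
lemma partSeq_append_pair {q : ℂ} (hq0 : q ≠ 0) {a b : ℕ} (hab : b + 1 ≤ a) (Λ : List ℕ) :
    ∀ A : ℤ, partSeq q (Λ ++ [a, b + 1]) A = partSeq q (Λ ++ [a + 1, b]) A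
      + q ^ (-((b : ℤ) + 1) * (1 + Λ.length)) * partSeq q (Λ ++ [a - (b + 1)]) (A - (b + 1)) := by
  induction Λ with
  | nil => intro A; simpa using partSeq_pair hab A
  | cons c Λ ih =>
    intro A
    have h1 : (Λ ++ [a + 1, b]).sum = (Λ ++ [a, b + 1]).sum := by simp; ring
    have h2 : (((Λ ++ [a, b + 1]).sum : ℕ) : ℤ)
        = ((Λ ++ [a - (b + 1)]).sum : ℕ) + 2 * (b + 1 : ℕ) := by
      simp; push_cast [hab]; ring
    have h3 := adjoinPart_shift hq0 c (b + 1) ((Λ ++ [a - (b + 1)]).sum : ℕ)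
      (partSeq_of_neg q (Λ ++ [a - (b + 1)])) A
    have e : q ^ (-((b : ℤ) + 1) * (1 + ((c :: Λ).length : ℤ)))
        = q ^ (-((b : ℤ) + 1) * (1 + Λ.length)) * q ^ (-((b : ℤ) + 1)) := by
      rw [← zpow_add₀ hq0]; congr 1; simp; ring
    simp only [List.cons_append, partSeq]
    rw [funext ih, adjoinPart_add_mul, h1, e, mul_assoc]
    simp only [Nat.cast_add b 1, Nat.cast_one] at h2 h3
    rw [h2, h3]

lemma partSeq_append_zero {q : ℂ} (Λ : List ℕ) : partSeq q (Λ ++ [0]) = partSeq q Λ := by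
  have h : partSeq q [0] = partSeq q [] := by
    funext A
    rw [partSeq_singleton, partSeq]
    congr 1
    simp only [Nat.cast_zero, eq_iff_iff]; omega
  simpa using partSeq_append_congr Λ (r := [0]) (r' := []) (by simp) h

/-! ### Nested q-multinomial sums. -/

/-- The `q`-multinomial sum `∑ q^{P₁² + ⋯ + P_N²} [L; P₁] [P₁; P₂] ⋯ [P_{N-1}; P_N]` over
`P₁ + ⋯ + P_N = A`. -/
def nestedSum (q : ℂ) : ℕ → ℕ → ℤ → ℂ
  | 0 => fun _ A => if A = 0 then 1 else 0
  | N + 1 => fun L A =>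
    ∑ P ∈ Finset.range (L + 1), q ^ ((P : ℤ) ^ 2) * qBin q L P * nestedSum q N P (A - P)

lemma nestedSum_of_neg (q : ℂ) (N : ℕ) : ∀ (L : ℕ) (A : ℤ), A < 0 → nestedSum q N L A = 0 := by
  induction N with
  | zero => exact fun L A hA => if_neg hA.ne
  | succ N ih =>
    intro L A hA
    refine Finset.sum_eq_zero fun P _ => ?_
    rw [ih P _ (by omega), mul_zero]

lemma nestedSum_zero {q : ℂ} (hq1 : ‖q‖ < 1) (N : ℕ) (A : ℤ) :
    nestedSum q N 0 A = if A = 0 then 1 else 0 := by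
  induction N with
  | zero => rfl
  | succ N ih =>
    rw [nestedSum]
    simp only [zero_add, Finset.range_one, Finset.sum_singleton, Nat.cast_zero, sub_zero]
    rw [ih, qBin_zero_right hq1 le_rfl]; simp

lemma nestedSum_one {q : ℂ} (L : ℕ) (A : ℤ) :
    nestedSum q 1 L A = q ^ (A ^ 2) * qBin q L A := by
  simp only [nestedSum]
  have h1 : ∀ P ∈ Finset.range (L + 1), q ^ ((P : ℤ) ^ 2) * qBin q L P
      * (if A - P = 0 then 1 else 0) = if P = A.toNat then (if A < 0 then 0 else
        q ^ (A ^ 2) * qBin q L A) else 0 := by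
    intro P _
    by_cases h : A = P
    · subst h; simp
    · rw [if_neg (by omega)]; split_ifs
      · simp
      · omega
      · simp
  rw [Finset.sum_congr rfl h1, Finset.sum_ite_eq']
  by_cases hA : A < 0
  · rw [qBin_eq_zero_of_neg q hA]; simp [hA]
  · rw [if_neg hA]
    split_ifs with h
    · rfl
    · rw [Finset.mem_range] at h
      rw [qBin_eq_zero_of_lt q (by omega), mul_zero]

/-- The two forms of the q-Pascal rule give two expansions in L, here and in `nestedSum_succ_left'`.
The recursion `nestedSum_rec` uses the first at A and the second at A - 1. -/
lemma nestedSum_succ_left {q : ℂ} (hq0 : q ≠ 0) (hq1 : ‖q‖ < 1) (N L : ℕ) (A : ℤ) :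
    nestedSum q (N + 1) (L + 1) A = nestedSum q (N + 1) L A
      + ∑ P ∈ Finset.range (L + 1), q ^ ((P : ℤ) ^ 2 + P + 1 + L) * qBin q L P
          * nestedSum q N (P + 1) (A - P - 1) := by
  have h : ∀ P ∈ Finset.range (L + 1 + 1), q ^ ((P : ℤ) ^ 2) * qBin q ((L + 1 : ℕ) : ℤ) P
      * nestedSum q N P (A - P) = q ^ ((P : ℤ) ^ 2) * qBin q L P * nestedSum q N P (A - P)
      + q ^ ((P : ℤ) ^ 2 + (L + 1 - P)) * qBin q L ((P : ℤ) - 1) * nestedSum q N P (A - P) := by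
    intro P _
    push_cast
    rw [qBin_pascal' hq0 hq1 (t := (L : ℤ) + 1) (by omega), zpow_add₀ hq0, add_sub_cancel_right]
    ring
  simp only [nestedSum]
  rw [Finset.sum_congr rfl h, Finset.sum_add_distrib, Finset.sum_range_succ,
    qBin_eq_zero_of_lt q (t := L) (by push_cast; omega), Finset.sum_range_succ' _ (L + 1),
    qBin_eq_zero_of_neg q (b := ((0 : ℕ) : ℤ) - 1) (by omega)]
  simp only [mul_zero, zero_mul, add_zero]
  congr 1
  refine Finset.sum_congr rfl fun P _ => ?_
  push_cast
  rw [add_sub_cancel_right, show A - ((P : ℤ) + 1) = A - P - 1 by ring]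
  congr 3; ring

lemma nestedSum_succ_left' {q : ℂ} (hq0 : q ≠ 0) (hq1 : ‖q‖ < 1) (N L : ℕ) (A : ℤ) :
    nestedSum q (N + 1) (L + 1) A
      = ∑ P ∈ Finset.range (L + 1), (q ^ ((P : ℤ) ^ 2 + P) * qBin q L P * nestedSum q N P (A - P)
        + q ^ (((P : ℤ) + 1) ^ 2) * qBin q L P * nestedSum q N (P + 1) (A - P - 1)) := by
  have h : ∀ P ∈ Finset.range (L + 1 + 1), q ^ ((P : ℤ) ^ 2) * qBin q ((L + 1 : ℕ) : ℤ) P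
      * nestedSum q N P (A - P) = q ^ ((P : ℤ) ^ 2 + P) * qBin q L P * nestedSum q N P (A - P)
      + q ^ ((P : ℤ) ^ 2) * qBin q L ((P : ℤ) - 1) * nestedSum q N P (A - P) := by
    intro P _
    push_cast
    rw [qBin_pascal hq0 hq1 (t := (L : ℤ) + 1) (by omega), zpow_add₀ hq0, add_sub_cancel_right]
    ring
  simp only [nestedSum]
  rw [Finset.sum_congr rfl h, Finset.sum_add_distrib, Finset.sum_range_succ,
    qBin_eq_zero_of_lt q (t := L) (by push_cast; omega), Finset.sum_range_succ' _ (L + 1),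
    qBin_eq_zero_of_neg q (b := ((0 : ℕ) : ℤ) - 1) (by omega), Finset.sum_add_distrib]
  simp only [mul_zero, zero_mul, add_zero]
  congr 1
  refine Finset.sum_congr rfl fun P _ => ?_
  push_cast
  rw [add_sub_cancel_right, show A - ((P : ℤ) + 1) = A - P - 1 by ring]

/-- By induction on N: after expanding the outer binomial, the terms besides the nested sum for L
are, for each P, a multiple of the same recursion for N at (P, A - P - 1). Its remaining term
reassembles the nested sum at A - N - 1. -/
lemma nestedSum_rec {q : ℂ} (hq0 : q ≠ 0) (hq1 : ‖q‖ < 1) (N : ℕ) : ∀ (L : ℕ) (A : ℤ),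
    nestedSum q N (L + 1) A - q ^ ((L : ℤ) + 1) * nestedSum q N (L + 1) (A - 1)
      = nestedSum q N L A - q ^ (2 * A - N - 1 + L) * nestedSum q N L (A - N - 1) := by
  induction N with
  | zero =>
    intro L A
    simp only [nestedSum, Nat.cast_zero, sub_zero]
    by_cases h : A - 1 = 0
    · rw [if_pos h, show A = 1 by omega, show (2 * 1 - 1 + (L : ℤ)) = L + 1 by ring]
    · simp [if_neg h]
  | succ N ih =>
    intro L A
    rw [nestedSum_succ_left hq0 hq1 N L A, nestedSum_succ_left' hq0 hq1 N L (A - 1)]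
    have : q ^ (2 * A - (N + 1 : ℕ) - 1 + L) * nestedSum q (N + 1) L (A - (N + 1 : ℕ) - 1)
        = q ^ ((L : ℤ) + 1) * ∑ P ∈ Finset.range (L + 1), (q ^ ((P : ℤ) ^ 2 + P) * qBin q L P
            * nestedSum q N P (A - 1 - P) + q ^ (((P : ℤ) + 1) ^ 2) * qBin q L P
            * nestedSum q N (P + 1) (A - 1 - P - 1))
        - ∑ P ∈ Finset.range (L + 1), q ^ ((P : ℤ) ^ 2 + P + 1 + L) * qBin q L P
          * nestedSum q N (P + 1) (A - P - 1) := by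
      rw [nestedSum, Finset.mul_sum, Finset.mul_sum, ← Finset.sum_sub_distrib]
      refine Finset.sum_congr rfl fun P _ => ?_
      have h := ih P (A - P - 1)
      rw [show A - 1 - (P : ℤ) = A - P - 1 by ring,
        show A - ((N + 1 : ℕ) : ℤ) - 1 - P = A - P - 1 - N - 1 by push_cast; ring]
      have e1 : q ^ (2 * A - (N + 1 : ℕ) - 1 + L) * q ^ ((P : ℤ) ^ 2)
          = q ^ ((P : ℤ) ^ 2 + P + 1 + L) * q ^ (2 * (A - P - 1) - N - 1 + P) := by
        rw [← zpow_add₀ hq0, ← zpow_add₀ hq0]; congr 1; push_cast; ring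
      have e2 : q ^ ((L : ℤ) + 1) * q ^ ((P : ℤ) ^ 2 + P) = q ^ ((P : ℤ) ^ 2 + P + 1 + L) := by
        rw [← zpow_add₀ hq0]; congr 1; ring
      have e3 : q ^ ((L : ℤ) + 1) * q ^ (((P : ℤ) + 1) ^ 2)
          = q ^ ((P : ℤ) ^ 2 + P + 1 + L) * q ^ ((P : ℤ) + 1) := by
        rw [← zpow_add₀ hq0, ← zpow_add₀ hq0]; congr 1; ring
      linear_combination qBin q L P * nestedSum q N P (A - P - 1 - N - 1) * e1
        - qBin q L P * nestedSum q N P (A - P - 1) * e2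
        - qBin q L P * nestedSum q N (P + 1) (A - P - 1 - 1) * e3
        + q ^ ((P : ℤ) ^ 2 + P + 1 + L) * qBin q L P * h
    rw [this]
    ring

/-- Multiplied by q^{-(L+1)A}, `nestedSum_rec` is exactly the first-difference formula for adjoining
one more part N to L parts N. -/
lemma partSeq_replicate {q : ℂ} (hq0 : q ≠ 0) (hq1 : ‖q‖ < 1) (N L : ℕ) :
    ∀ A : ℤ, partSeq q (List.replicate L N) A = q ^ (-(L * A)) * nestedSum q N L A := by
  induction L with
  | zero => intro A; rw [nestedSum_zero hq1]; simp [partSeq]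
  | succ L ih =>
    refine eq_of_sub_eq (fun A hA => ?_) (fun A => ?_)
    · rw [partSeq_of_neg _ _ _ hA, nestedSum_of_neg _ _ _ _ hA, mul_zero]
    · rw [List.replicate_succ, partSeq, adjoinPart_sub _ _ _ (partSeq_of_neg q _), ih, ih]
      have h := nestedSum_rec hq0 hq1 N L A
      simp only [List.sum_replicate, smul_eq_mul]
      push_cast
      have e1 : q ^ (-A) * q ^ (-(L * A)) = q ^ (-((L + 1) * A)) := by
        rw [← zpow_add₀ hq0]; congr 1; ring
      have e2 : q ^ (A - N - 1 - L * N) * q ^ (-(L * (A - N - 1)))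
          = q ^ (-((L + 1) * A)) * q ^ (2 * A - N - 1 + L) := by
        rw [← zpow_add₀ hq0, ← zpow_add₀ hq0]; congr 1; ring
      have e3 : q ^ (-((L + 1) * (A - 1))) = q ^ (-((L + 1) * A)) * q ^ ((L : ℤ) + 1) := by
        rw [← zpow_add₀ hq0]; congr 1; ring
      rw [e3]
      linear_combination nestedSum q N L A * e1 - nestedSum q N L (A - N - 1) * e2
        - q ^ (-((L + 1) * A)) * h

/-! ### The bilinear form min(a, b). -/

/-- The linear form `v ↦ ∑ b, min (a, b) v_b`, where the entry at `b : Fin N` belongs to the part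
`b + 1`. -/
def minSum {N : ℕ} (a : ℕ) : (Fin N → ℤ) →ₗ[ℤ] ℤ where
  toFun v := ∑ b, (min a (b.val + 1) : ℕ) * v b
  map_add' u v := by simp [mul_add, Finset.sum_add_distrib]
  map_smul' c v := by
    simp only [Pi.smul_apply, smul_eq_mul, RingHom.id_apply, Finset.mul_sum]
    exact Finset.sum_congr rfl fun b _ => by ring

lemma minSum_apply {N : ℕ} (a : ℕ) (v : Fin N → ℤ) :
    minSum a v = ∑ b, ((min a (b.val + 1) : ℕ) : ℤ) * v b := rfl

/-- The bilinear form `∑ b c, min (b, c) u_b v_c`. -/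
def minForm {N : ℕ} (u v : Fin N → ℤ) : ℤ := ∑ b, u b * minSum (b.val + 1) v

/-- The unit vector belonging to the part `a`; it is zero for `a = 0` and for `N < a`. -/
def partVec (N a : ℕ) : Fin N → ℤ := fun c => if c.val + 1 = a then 1 else 0

lemma partVec_zero (N : ℕ) : partVec N 0 = 0 := by
  funext c; simp [partVec]

lemma minSum_zero_left {N : ℕ} (v : Fin N → ℤ) : minSum 0 v = 0 := by
  simp [minSum_apply]

lemma sum_mul_partVec {N a : ℕ} (f : ℕ → ℤ) (hf : f 0 = 0) (ha : a ≤ N) :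
    ∑ b : Fin N, f (b.val + 1) * partVec N a b = f a := by
  rcases Nat.eq_zero_or_pos a with rfl | h
  · simp [partVec_zero, hf]
  · rw [Finset.sum_eq_single (⟨a - 1, by omega⟩ : Fin N)]
    · simp [partVec, Nat.sub_add_cancel h]
    · intro c _ hc
      rw [partVec, if_neg, mul_zero]
      intro h'
      exact hc (Fin.ext (by simp; omega))
    · simp

lemma minSum_partVec {N a : ℕ} (c : ℕ) (ha : a ≤ N) : minSum c (partVec N a) = (min c a : ℕ) :=
  sum_mul_partVec (fun b => ((min c b : ℕ) : ℤ)) (by simp) ha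

lemma minForm_partVec_left {N a : ℕ} (ha : a ≤ N) (v : Fin N → ℤ) :
    minForm (partVec N a) v = minSum a v := by
  rw [← sum_mul_partVec (fun b => minSum b v) (minSum_zero_left v) ha, minForm]
  exact Finset.sum_congr rfl fun b _ => mul_comm _ _

lemma minForm_comm {N : ℕ} (u v : Fin N → ℤ) : minForm u v = minForm v u := by
  simp only [minForm, minSum_apply, Finset.mul_sum]
  rw [Finset.sum_comm]
  refine Finset.sum_congr rfl fun b _ => Finset.sum_congr rfl fun c _ => ?_
  rw [min_comm]; ring

lemma minForm_sub_left {N : ℕ} (u u' v : Fin N → ℤ) :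
    minForm (u - u') v = minForm u v - minForm u' v := by
  simp [minForm, sub_mul]

lemma minForm_add_right {N : ℕ} (u v v' : Fin N → ℤ) :
    minForm u (v + v') = minForm u v + minForm u v' := by
  simp [minForm, mul_add, Finset.sum_add_distrib]

lemma minForm_smul_right {N : ℕ} (x : ℤ) (u v : Fin N → ℤ) :
    minForm u (x • v) = x * minForm u v := by
  rw [minForm, minForm, Finset.mul_sum]
  refine Finset.sum_congr rfl fun b _ => ?_
  rw [map_smul, smul_eq_mul]; ring

lemma minForm_sub_right {N : ℕ} (u v v' : Fin N → ℤ) :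
    minForm u (v - v') = minForm u v - minForm u v' := by
  simp [minForm, mul_sub]

lemma minForm_partVec_right {N a : ℕ} (ha : a ≤ N) (v : Fin N → ℤ) :
    minForm v (partVec N a) = minSum a v := by
  rw [minForm_comm, minForm_partVec_left ha]

/-- min(a, b) is the Green function of the discrete Laplacian with value 0 at a = 0. -/
lemma minSum_second_difference {N : ℕ} (v : Fin N → ℤ) (a : Fin N) :
    minSum a.val v + minSum (a.val + 2) v = 2 * minSum (a.val + 1) v - v a := by
  have h : ∀ b : Fin N, ((min a.val (b.val + 1) : ℕ) : ℤ) * v b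
      + ((min (a.val + 2) (b.val + 1) : ℕ) : ℤ) * v b
      = 2 * (((min (a.val + 1) (b.val + 1) : ℕ) : ℤ) * v b) - if b = a then v b else 0 := by
    intro b
    split_ifs with h
    · subst h
      rw [min_eq_left (Nat.le_succ _), min_eq_right (by omega), min_self]
      push_cast; ring
    · have h' : b.val ≠ a.val := fun h' => h (Fin.ext h')
      rcases lt_or_gt_of_ne h' with h' | h'
      · rw [min_eq_right (by omega), min_eq_right (by omega), min_eq_right (by omega)]; ring
      · rw [min_eq_left (by omega), min_eq_left (by omega), min_eq_left (by omega)]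
        push_cast; ring
  simp only [minSum_apply]
  rw [← Finset.sum_add_distrib, Finset.sum_congr rfl fun b _ => h b, Finset.sum_sub_distrib,
    Finset.mul_sum, Finset.sum_ite_eq']
  simp

lemma minSum_of_support {N a : ℕ} {v : Fin N → ℤ} (h : ∀ c : Fin N, c.val + 1 < a → v c = 0) :
    minSum a v = a * ∑ c, v c := by
  rw [minSum_apply, Finset.mul_sum]
  refine Finset.sum_congr rfl fun c _ => ?_
  by_cases hc : c.val + 1 < a
  · rw [h c hc]; simp
  · rw [min_eq_left (by omega)]

lemma le_minSum_top {N : ℕ} {v : Fin N → ℤ} (hv : ∀ c, 0 ≤ v c) (c : Fin N) :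
    v c ≤ minSum N v := by
  have h1 : ((min N (c.val + 1) : ℕ) : ℤ) * v c ≤ minSum N v :=
    Finset.single_le_sum (f := fun b : Fin N => ((min N (b.val + 1) : ℕ) : ℤ) * v b)
      (fun b _ => mul_nonneg (by positivity) (hv b)) (Finset.mem_univ c)
  have h2 : (1 : ℤ) ≤ ((min N (c.val + 1) : ℕ) : ℤ) := by
    have := c.isLt
    exact_mod_cast (by omega : 1 ≤ min N (c.val + 1))
  nlinarith [hv c]

/-! ### Fermionic sums and their exchange rule. -/

/-- The summand of `fermSum`. -/
def fermTerm (q : ℂ) {n : ℕ} (L : Fin (n + 1) → ℤ) (A : ℤ) (ν : Fin (n + 1) → ℤ) : ℂ :=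
  q ^ (minForm ν ν - minForm ν L)
    * (∏ c : Fin n, qBin q (minSum (c.val + 1) (L - (2 : ℤ) • ν) + ν c.castSucc) (ν c.castSucc))
    * (qBin q (ν (Fin.last n) + (A - minSum (n + 1) ν)) (ν (Fin.last n))
      * qBin q (ν (Fin.last n) + (minSum (n + 1) L - A - minSum (n + 1) ν)) (ν (Fin.last n)))

/-- The fermionic sum over string configurations with `L_a` sites of spin `a / 2`, in which all
strings of length at least `n + 1` are merged. -/
def fermSum (q : ℂ) {n : ℕ} (L : Fin (n + 1) → ℤ) (A : ℤ) : ℂ := ∑ᶠ ν, fermTerm q L A ν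

lemma nonneg_of_qBin_ne_zero {q : ℂ} {t b : ℤ} (h : qBin q t b ≠ 0) : 0 ≤ b ∧ b ≤ t := by
  by_contra h'
  exact h (if_neg (by omega))

lemma fermTerm_support {q : ℂ} {n : ℕ} {L : Fin (n + 1) → ℤ} {A : ℤ} {ν : Fin (n + 1) → ℤ}
    (h : fermTerm q L A ν ≠ 0) : (∀ c, 0 ≤ ν c) ∧ minSum (n + 1) ν ≤ A
      ∧ A + minSum (n + 1) ν ≤ minSum (n + 1) L := by
  rw [fermTerm, mul_ne_zero_iff, mul_ne_zero_iff, mul_ne_zero_iff] at h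
  obtain ⟨⟨-, h1⟩, h2, h3⟩ := h
  have h2 := nonneg_of_qBin_ne_zero h2
  have h3 := nonneg_of_qBin_ne_zero h3
  refine ⟨fun c => ?_, by omega, by omega⟩
  refine Fin.lastCases h2.1 (fun c => ?_) c
  exact (nonneg_of_qBin_ne_zero (Finset.prod_ne_zero_iff.mp h1 c (Finset.mem_univ c))).1

lemma fermTerm_finite (q : ℂ) {n : ℕ} (L : Fin (n + 1) → ℤ) (A : ℤ) :
    (Function.support (fermTerm q L A)).Finite := by
  refine (Set.finite_Icc (0 : Fin (n + 1) → ℤ) fun _ => A).subset fun ν hν => ?_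
  obtain ⟨h1, h2, -⟩ := fermTerm_support hν
  exact ⟨h1, fun c => (le_minSum_top h1 c).trans h2⟩

/-- This is the q-Pascal rule for the binomial of strings of length a + 1. Replacing two parts a + 1
by a and a + 2 lowers only the vacancy number at a + 1, by one; removing both parts together with
one string of that length leaves all vacancy numbers unchanged. All other factors agree in the three
terms. -/
lemma fermTerm_rec {q : ℂ} (hq0 : q ≠ 0) (hq1 : ‖q‖ < 1) {n : ℕ} (a : Fin n)
    {L : Fin (n + 1) → ℤ} (hL : -1 ≤ L a.castSucc) (A : ℤ) (ν : Fin (n + 1) → ℤ) :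
    fermTerm q (L + (2 : ℤ) • partVec (n + 1) (a.val + 1)) A ν
      = fermTerm q (L + partVec (n + 1) a.val + partVec (n + 1) (a.val + 2)) A ν
        + q ^ (-((a.val : ℤ) + 1) - minSum (a.val + 1) L)
          * fermTerm q L (A - (a.val + 1)) (ν - partVec (n + 1) (a.val + 1)) := by
  have ha := a.isLt
  set e := partVec (n + 1) (a.val + 1) with he
  set L' := L + (2 : ℤ) • e with hL'
  set p : Fin n → ℤ := fun c => minSum (c.val + 1) (L' - (2 : ℤ) • ν) with hp
  have hM : ∀ c : ℕ, minSum c e = (min c (a.val + 1) : ℕ) := fun c => minSum_partVec c (by omega)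
  have e1 : ∀ c : Fin n, e c.castSucc = if c = a then 1 else 0 := by
    intro c
    simp only [he, partVec, Fin.val_castSucc, add_left_inj, Fin.ext_iff]
  have e2 : e (Fin.last n) = 0 := by
    simp only [he, partVec, Fin.val_last]; exact if_neg (by omega)
  have p2 : ∀ c : Fin n, minSum (c.val + 1) (L + partVec (n + 1) a.val
      + partVec (n + 1) (a.val + 2) - (2 : ℤ) • ν) = p c - if c = a then 1 else 0 := by
    intro c
    simp only [hp, hL', map_sub, map_add, map_smul, hM, minSum_partVec _ (show a.val ≤ n + 1 by omega),
      minSum_partVec _ (show a.val + 2 ≤ n + 1 by omega), smul_eq_mul]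
    by_cases h : c = a
    · subst h
      rw [if_pos rfl, min_eq_right (by omega), min_eq_left (by omega), min_self]
      push_cast; ring
    · rw [if_neg h]
      have h' : c.val ≠ a.val := fun h' => h (Fin.ext h')
      rcases lt_or_gt_of_ne h' with h' | h'
      · rw [min_eq_left (by omega), min_eq_left (by omega), min_eq_left (by omega)]; ring
      · rw [min_eq_right (by omega), min_eq_right (by omega), min_eq_right (by omega)]
        push_cast; ring
  have p3 : ∀ c : Fin n, minSum (c.val + 1) (L - (2 : ℤ) • (ν - e)) = p c := by
    intro c
    simp only [hp, hL', map_sub, map_add, map_smul, smul_eq_mul]; ring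
  have w1 : minSum (n + 1) L' = minSum (n + 1) L + 2 * (a.val + 1) := by
    rw [hL', map_add, map_smul, hM, min_eq_right (by omega)]; simp
  have w2 : minSum (n + 1) (L + partVec (n + 1) a.val + partVec (n + 1) (a.val + 2))
      = minSum (n + 1) L + 2 * (a.val + 1) := by
    rw [map_add, map_add, minSum_partVec _ (by omega), minSum_partVec _ (by omega),
      min_eq_right (by omega), min_eq_right (by omega)]
    push_cast; ring
  have w3 : minSum (n + 1) (ν - e) = minSum (n + 1) ν - (a.val + 1) := by
    rw [map_sub, hM, min_eq_right (by omega)]; push_cast; ring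
  have f1 : minForm ν L' = minForm ν L + 2 * minSum (a.val + 1) ν := by
    rw [hL', minForm_add_right, minForm_smul_right, minForm_partVec_right (by omega)]
  have f2 : minForm ν (L + partVec (n + 1) a.val + partVec (n + 1) (a.val + 2))
      = minForm ν L + 2 * minSum (a.val + 1) ν - ν a.castSucc := by
    have := minSum_second_difference ν a.castSucc
    rw [Fin.val_castSucc] at this
    rw [minForm_add_right, minForm_add_right, minForm_partVec_right (by omega),
      minForm_partVec_right (by omega)]
    linarith
  have f3 : minForm (ν - e) (ν - e) - minForm (ν - e) L
      = minForm ν ν - minForm ν L' + (a.val + 1) + minSum (a.val + 1) L := by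
    rw [minForm_sub_right, minForm_sub_left, minForm_sub_left, minForm_sub_left, f1,
      minForm_partVec_right (by omega), minForm_partVec_right (by omega),
      minForm_partVec_left (by omega), minForm_partVec_left (by omega), hM, min_self]
    push_cast; ring
  simp only [fermTerm]
  rw [f2, f3, f1, w1, w2, w3, Pi.sub_apply, e2, sub_zero,
    ← Finset.mul_prod_erase Finset.univ _ (Finset.mem_univ a),
    ← Finset.mul_prod_erase Finset.univ _ (Finset.mem_univ a),
    ← Finset.mul_prod_erase Finset.univ _ (Finset.mem_univ a)]
  have r2 : ∏ c ∈ Finset.univ.erase a, qBin q (minSum (c.val + 1) (L + partVec (n + 1) a.val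
      + partVec (n + 1) (a.val + 2) - (2 : ℤ) • ν) + ν c.castSucc) (ν c.castSucc)
      = ∏ c ∈ Finset.univ.erase a, qBin q (p c + ν c.castSucc) (ν c.castSucc) := by
    refine Finset.prod_congr rfl fun c hc => ?_
    rw [p2, if_neg (Finset.ne_of_mem_erase hc), sub_zero]
  have r3 : ∏ c ∈ Finset.univ.erase a, qBin q (minSum (c.val + 1) (L - (2 : ℤ) • (ν - e))
      + (ν - e) c.castSucc) ((ν - e) c.castSucc)
      = ∏ c ∈ Finset.univ.erase a, qBin q (p c + ν c.castSucc) (ν c.castSucc) := by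
    refine Finset.prod_congr rfl fun c hc => ?_
    rw [p3, Pi.sub_apply, e1, if_neg (Finset.ne_of_mem_erase hc), sub_zero]
  rw [r2, r3, p2, p3, if_pos rfl, Pi.sub_apply, e1, if_pos rfl]
  change q ^ _ * (qBin q (p a + _) _ * ∏ c ∈ Finset.univ.erase a,
    qBin q (p c + ν c.castSucc) (ν c.castSucc)) * _ = _
  set X := ∏ c ∈ Finset.univ.erase a, qBin q (p c + ν c.castSucc) (ν c.castSucc) with hX
  rw [show A - (a.val + 1 : ℤ) - (minSum (n + 1) ν - (a.val + 1)) = A - minSum (n + 1) ν by ring,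
    show minSum (n + 1) L - (A - (a.val + 1 : ℤ)) - (minSum (n + 1) ν - (a.val + 1))
      = minSum (n + 1) L + 2 * (a.val + 1) - A - minSum (n + 1) ν by ring]
  set Y := qBin q (ν (Fin.last n) + (A - minSum (n + 1) ν)) (ν (Fin.last n))
    * qBin q (ν (Fin.last n) + (minSum (n + 1) L + 2 * (a.val + 1) - A - minSum (n + 1) ν))
      (ν (Fin.last n)) with hY
  set x := ν a.castSucc with hx
  have g1 : q ^ (minForm ν ν - (minForm ν L + 2 * minSum (a.val + 1) ν - x))
      = q ^ (minForm ν ν - (minForm ν L + 2 * minSum (a.val + 1) ν)) * q ^ x := by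
    rw [← zpow_add₀ hq0]; congr 1; ring
  have g2 : q ^ (minForm ν ν - (minForm ν L + 2 * minSum (a.val + 1) ν))
      = q ^ (-((a.val : ℤ) + 1) - minSum (a.val + 1) L) * q ^ (minForm ν ν
        - (minForm ν L + 2 * minSum (a.val + 1) ν) + (a.val + 1) + minSum (a.val + 1) L) := by
    rw [← zpow_add₀ hq0]; congr 1; ring
  have key : qBin q (p a + x) x * (X * Y)
      = (q ^ x * qBin q (p a - 1 + x) x + qBin q (p a + (x - 1)) (x - 1)) * (X * Y) := by
    by_cases h0 : p a + x = 0 ∧ x = 0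
    -- In the case excluded from q-Pascal the product of the other factors vanishes: the vacancy
    -- number at a + 1 is 0 and its second difference is -(L_a + 2) < 0 by the bound on L, so a
    -- neighbouring vacancy number is negative and kills a binomial.
    · suffices X * Y = 0 by rw [this, mul_zero, mul_zero]
      have hd := minSum_second_difference (L' - (2 : ℤ) • ν) a.castSucc
      have hv : (L' - (2 : ℤ) • ν) a.castSucc = L a.castSucc + 2 := by
        simp only [hL', Pi.sub_apply, Pi.add_apply, Pi.smul_apply, smul_eq_mul, e1, if_pos]
        rw [← hx, h0.2]; ring
      have hpa : minSum (a.val + 1) (L' - (2 : ℤ) • ν) = 0 := by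
        have : p a = 0 := by omega
        exact this
      rw [Fin.val_castSucc, hv, hpa] at hd
      rcases lt_or_ge (minSum a.val (L' - (2 : ℤ) • ν)) 0 with hneg | hneg
      · have ha0 : a.val ≠ 0 := fun h => by
          rw [h, minSum_zero_left] at hneg; exact lt_irrefl _ hneg
        have : X = 0 := by
          refine Finset.prod_eq_zero (i := ⟨a.val - 1, by omega⟩) ?_ ?_
          · simp only [Finset.mem_erase, Finset.mem_univ, and_true, ne_eq, Fin.ext_iff]; omega
          · refine qBin_eq_zero_of_lt q ?_
            simp only [hp]
            rw [Nat.sub_add_cancel (Nat.one_le_iff_ne_zero.mpr ha0)]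
            omega
        rw [this, zero_mul]
      · have hneg' : minSum (a.val + 2) (L' - (2 : ℤ) • ν) < 0 := by omega
        by_cases hn : a.val + 1 < n
        · have : X = 0 := by
            refine Finset.prod_eq_zero (i := ⟨a.val + 1, hn⟩) ?_ ?_
            · simp only [Finset.mem_erase, Finset.mem_univ, and_true, ne_eq, Fin.ext_iff]; omega
            · refine qBin_eq_zero_of_lt q ?_
              simp only [hp]
              rw [show a.val + 1 + 1 = a.val + 2 from rfl]
              omega
          rw [this, zero_mul]
        -- The right neighbour is the top length: its vacancy number is the sum of the two excesses
        -- in the merged binomials, so one of these is negative.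
        · have hn' : a.val + 2 = n + 1 := by omega
          rw [hn', map_sub, map_smul, w1, smul_eq_mul] at hneg'
          have : Y = 0 := by
            rcases lt_or_ge (A - minSum (n + 1) ν) 0 with h | h
            · rw [hY, qBin_eq_zero_of_lt q (by omega), zero_mul]
            · rw [hY, qBin_eq_zero_of_lt q (t := ν (Fin.last n) + (minSum (n + 1) L
                + 2 * (a.val + 1) - A - minSum (n + 1) ν)) (by omega), mul_zero]
          rw [this, mul_zero]
    · rw [qBin_pascal hq0 hq1 h0, show p a + x - 1 = p a - 1 + x by ring,
        show p a + (x - 1) = p a - 1 + x by ring]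
  rw [g1]
  linear_combination q ^ (minForm ν ν - (minForm ν L + 2 * minSum (a.val + 1) ν)) * key
    + qBin q (p a + (x - 1)) (x - 1) * X * Y * g2

lemma fermSum_rec {q : ℂ} (hq0 : q ≠ 0) (hq1 : ‖q‖ < 1) {n : ℕ} (a : Fin n)
    {L : Fin (n + 1) → ℤ} (hL : -1 ≤ L a.castSucc) (A : ℤ) :
    fermSum q (L + (2 : ℤ) • partVec (n + 1) (a.val + 1)) A
      = fermSum q (L + partVec (n + 1) a.val + partVec (n + 1) (a.val + 2)) A
        + q ^ (-((a.val : ℤ) + 1) - minSum (a.val + 1) L) * fermSum q L (A - (a.val + 1)) := by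
  have h1 : fermSum q L (A - (a.val + 1))
      = ∑ᶠ ν, fermTerm q L (A - (a.val + 1)) (ν - partVec (n + 1) (a.val + 1)) :=
    (finsum_comp_equiv (Equiv.subRight (partVec (n + 1) (a.val + 1)))
      (f := fermTerm q L (A - (a.val + 1)))).symm
  have hfin : (Function.support fun ν => fermTerm q L (A - (a.val + 1))
      (ν - partVec (n + 1) (a.val + 1))).Finite :=
    (fermTerm_finite q L (A - (a.val + 1))).preimage
      (Equiv.subRight (partVec (n + 1) (a.val + 1))).injective.injOn
  rw [h1, mul_finsum, fermSum, fermSum, ← finsum_add_distrib (fermTerm_finite q _ A)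
    (hfin.subset fun ν hν => right_ne_zero_of_mul hν)]
  exact finsum_congr fun ν => fermTerm_rec hq0 hq1 a hL A ν

lemma partVec_apply_of_ne {N a : ℕ} {c : Fin N} (h : c.val + 1 ≠ a) : partVec N a c = 0 := if_neg h

lemma sum_partVec {N a : ℕ} (h1 : 1 ≤ a) (h2 : a ≤ N) : ∑ c, partVec N a c = 1 := by
  have := sum_mul_partVec (N := N) (a := a) (fun b => if b = 0 then 0 else 1) (by simp) h2
  simpa [Nat.one_le_iff_ne_zero.mp h1] using this

/-- Fermionic counterpart of `partSeq_append_pair`; the sum of the entries of L plays the role of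
the length of Λ. The diagonal case b = a is `fermSum_rec`, and the others follow by induction on a.
The entry of L at a may be -1 because the induction applies the statement after subtracting a unit
vector. -/
lemma fermSum_pair {q : ℂ} (hq0 : q ≠ 0) (hq1 : ‖q‖ < 1) {n : ℕ} (a : ℕ) :
    ∀ b, 1 ≤ b → b ≤ a → a ≤ n → ∀ L : Fin (n + 1) → ℤ, (∀ c, c.val + 1 < a → L c = 0) →
    (∀ c, c.val + 1 = a → -1 ≤ L c) → ∀ A : ℤ,
    fermSum q (L + partVec (n + 1) a + partVec (n + 1) b) A
      = fermSum q (L + partVec (n + 1) (a + 1) + partVec (n + 1) (b - 1)) A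
        + q ^ (-(b : ℤ) * (1 + ∑ c, L c)) * fermSum q (L + partVec (n + 1) (a - b)) (A - b) := by
  induction a with
  | zero => intro b h1 h2; omega
  | succ a ih =>
    intro b hb hba han L hL hLa A
    rcases hba.eq_or_lt with rfl | hlt
    · have h := fermSum_rec hq0 hq1 ⟨a, by omega⟩ (hLa (Fin.castSucc ⟨a, by omega⟩) rfl) A
      simp only at h
      rw [add_tsub_cancel_right, Nat.sub_self, partVec_zero, add_zero, add_assoc, ← two_smul ℤ, h,
        minSum_of_support hL, add_right_comm, show a + 2 = a + 1 + 1 from rfl]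
      push_cast
      congr 3; ring
    · have hba' : b ≤ a := by omega
      have ha : 1 ≤ a := hb.trans hba'
      set e := partVec (n + 1) with he
      set L₀ := L - e a + e (b - 1) with hL0
      have hsum : ∑ c, (L - e a) c = ∑ c, L c - 1 := by
        simp only [Pi.sub_apply, Finset.sum_sub_distrib]
        rw [sum_partVec ha (by omega)]
      have hsum1 : ∑ c, (L - e a + e (a + 1)) c = ∑ c, L c := by
        simp only [Pi.add_apply, Finset.sum_add_distrib]
        rw [hsum, sum_partVec (by omega) (by omega)]; ring
      have hne : ∀ c : Fin (n + 1), ∀ k, c.val + 1 ≠ k → e k c = 0 := fun c k h =>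
        partVec_apply_of_ne h
      -- Three exchanges are combined. With one part a borrowed from L, `h2` trades (a, b) for (a +
      -- 1, b - 1); `h1` then splits the resulting pair of parts a + 1; `h3` trades (a, a + 1 - b)
      -- in the remainder. The sums for `L₀` in `h1` and `h3` cancel.
      have h1 := fermSum_rec hq0 hq1 (n := n) ⟨a, by omega⟩ (L := L₀) (by
        rw [hL0, Pi.add_apply, Pi.sub_apply, hne _ a (by simp), hne _ (b - 1) (by simp; omega)]
        rw [sub_zero, add_zero]
        exact hLa (Fin.castSucc ⟨a, by omega⟩) rfl) A
      simp only at h1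
      have h2 := ih b hb hba' (by omega) (L - e a + e (a + 1))
        (fun c hc => by
          rw [Pi.add_apply, Pi.sub_apply, hne c a (by omega), hne c (a + 1) (by omega),
            hL c (by omega)]; simp)
        (fun c hc => by
          rw [Pi.add_apply, Pi.sub_apply, hne c (a + 1) (by omega), hL c (by omega)]
          simp [he, partVec, hc]) A
      have h3 := ih (a + 1 - b) (by omega) (by omega) (by omega) (L - e a)
        (fun c hc => by rw [Pi.sub_apply, hne c a (by omega), hL c (by omega)]; simp)
        (fun c hc => by rw [Pi.sub_apply, hL c (by omega)]; simp [he, partVec, hc]) (A - b)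
      rw [hsum1] at h2
      rw [hsum, show a + 1 - b - 1 = a - b by omega, show a - (a + 1 - b) = b - 1 by omega] at h3
      have k1 : L₀ + e a + e (a + 2) = L + e (a + 1 + 1) + e (b - 1) := by rw [hL0]; abel
      have k2 : L - e a + e (a + 1) + e a + e b = L + e (a + 1) + e b := by abel
      have k3 : L - e a + e (a + 1) + e (a + 1) + e (b - 1) = L₀ + (2 : ℤ) • e (a + 1) := by
        rw [hL0, two_smul]; abel
      have k4 : L - e a + e a + e (a + 1 - b) = L + e (a + 1 - b) := by abel
      rw [k1] at h1
      rw [k2, k3] at h2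
      rw [k4, show A - b - ((a + 1 - b : ℕ) : ℤ) = A - (a + 1) by push_cast [hba]; ring] at h3
      have hw : minSum (a + 1) L₀ = (a + 1) * ∑ c, L c - a + (b - 1 : ℕ) := by
        rw [hL0, map_add, map_sub, minSum_partVec _ (by omega), minSum_partVec _ (by omega),
          minSum_of_support hL, min_eq_right (by omega), min_eq_right (by omega)]
        push_cast; ring
      have hx : q ^ (-((a : ℤ) + 1) - minSum (a + 1) L₀) = q ^ (-(b : ℤ) * (1 + ∑ c, L c))
          * q ^ (-((a + 1 - b : ℕ) : ℤ) * (1 + (∑ c, L c - 1))) := by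
        rw [← zpow_add₀ hq0, hw]; congr 1; push_cast [hba, hb]; ring
      linear_combination h2 + h1 - q ^ (-(b : ℤ) * (1 + ∑ c, L c)) * h3
        + fermSum q L₀ (A - (a + 1)) * hx

/-! ### Merging the longest strings. -/

lemma finsum_int_eq_sum_range {f : ℤ → ℂ} {T : ℕ} (hf : ∀ S, f S ≠ 0 → 0 ≤ S ∧ S ≤ T) :
    ∑ᶠ S, f S = ∑ S ∈ Finset.range (T + 1), f S := by
  rw [finsum_eq_sum_of_support_subset (s := (Finset.range (T + 1)).map Nat.castEmbedding) _ ?_,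
    Finset.sum_map]
  · rfl
  · intro S hS
    obtain ⟨h1, h2⟩ := hf S hS
    simp only [Finset.coe_map, Set.mem_image, Finset.mem_coe, Finset.mem_range]
    exact ⟨S.toNat, by omega, by simp [h1]⟩

/-- If one of the parameters is negative, both sides vanish, so the identity holds for all integers
and can be applied inside a fermionic sum without constraints. -/
lemma q_saalschuetz_finsum {q : ℂ} (hq0 : q ≠ 0) (hq1 : ‖q‖ < 1) (I J T : ℤ) :
    ∑ᶠ S : ℤ, q ^ (S ^ 2) * qBin q (I + J + T - S) (T - S) * (qBin q J S * qBin q I S)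
      = qBin q (T + J) T * qBin q (T + I) T := by
  by_cases h : 0 ≤ I ∧ 0 ≤ J ∧ 0 ≤ T
  · obtain ⟨hI, hJ, hT⟩ := h
    lift I to ℕ using hI
    lift J to ℕ using hJ
    lift T to ℕ using hT
    rw [finsum_int_eq_sum_range (T := T), ← q_saalschuetz hq0 hq1]
    · exact Finset.sum_congr rfl fun S _ => by ring
    · intro S hS
      have h1 := nonneg_of_qBin_ne_zero (right_ne_zero_of_mul (left_ne_zero_of_mul hS))
      have h2 := nonneg_of_qBin_ne_zero (left_ne_zero_of_mul (right_ne_zero_of_mul hS))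
      omega
  · have hz : ∀ S : ℤ, q ^ (S ^ 2) * qBin q (I + J + T - S) (T - S)
        * (qBin q J S * qBin q I S) = 0 := by
      intro S
      by_contra hS
      have h1 := nonneg_of_qBin_ne_zero (right_ne_zero_of_mul (left_ne_zero_of_mul hS))
      have h2 := nonneg_of_qBin_ne_zero (left_ne_zero_of_mul (right_ne_zero_of_mul hS))
      have h3 := nonneg_of_qBin_ne_zero (right_ne_zero_of_mul (right_ne_zero_of_mul hS))
      omega
    rw [finsum_congr hz, finsum_zero]
    by_contra hS
    have h1 := nonneg_of_qBin_ne_zero (left_ne_zero_of_mul (Ne.symm hS))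
    have h2 := nonneg_of_qBin_ne_zero (right_ne_zero_of_mul (Ne.symm hS))
    omega

/-- Merging the strings of the two largest lengths. -/
def mergeEquiv (n : ℕ) : (Fin (n + 2) → ℤ) ≃ (Fin (n + 1) → ℤ) × ℤ where
  toFun ν := ((fun c => ν c.castSucc) + ν (Fin.last _) • partVec (n + 1) (n + 1), ν (Fin.last _))
  invFun x := Fin.snoc (α := fun _ => ℤ) (x.1 - x.2 • partVec (n + 1) (n + 1)) x.2
  left_inv ν := by
    funext c
    refine Fin.lastCases ?_ (fun c => ?_) c <;> simp
  right_inv x := by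
    refine Prod.ext (funext fun c => ?_) ?_ <;> simp

lemma minSum_snoc {n : ℕ} (a : ℕ) (v : Fin (n + 1) → ℤ) (S : ℤ) :
    minSum a (Fin.snoc (α := fun _ => ℤ) v S : Fin (n + 2) → ℤ)
      = minSum a v + (min a (n + 2) : ℕ) * S := by
  rw [minSum_apply, Fin.sum_univ_castSucc]
  simp only [Fin.snoc_castSucc, Fin.snoc_last, Fin.val_castSucc, Fin.val_last]
  rfl

lemma minSum_succ_top {N : ℕ} (v : Fin N → ℤ) : minSum (N + 1) v = minSum N v := by
  rw [minSum_apply, minSum_apply]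
  refine Finset.sum_congr rfl fun b _ => ?_
  have := b.isLt
  rw [min_eq_right (by omega), min_eq_right (by omega)]

lemma minSum_merge {n : ℕ} {a : ℕ} (ha : a ≤ n + 1) (u : Fin (n + 1) → ℤ) (S : ℤ) :
    minSum a (Fin.snoc (α := fun _ => ℤ) (u - S • partVec (n + 1) (n + 1)) S : Fin (n + 2) → ℤ)
      = minSum a u := by
  rw [minSum_snoc, map_sub, map_smul, minSum_partVec _ le_rfl, min_eq_left ha,
    min_eq_left (by omega), smul_eq_mul]
  ring

lemma minSum_top_merge {n : ℕ} (u : Fin (n + 1) → ℤ) (S : ℤ) :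
    minSum (n + 2) (Fin.snoc (α := fun _ => ℤ) (u - S • partVec (n + 1) (n + 1)) S :
      Fin (n + 2) → ℤ) = minSum (n + 1) u + S := by
  have h := minSum_succ_top u
  rw [minSum_snoc, map_sub, map_smul, minSum_partVec _ le_rfl, min_self,
    min_eq_right (by omega), smul_eq_mul, h]
  push_cast; ring

/-- Moving S strings from the length n + 1 to n + 2 changes the linear form by S times the increment
of `minSum`. With the vector itself as second argument this yields the extra S², and nothing if the
second vector has no entry at n + 2. -/
lemma minForm_merge {n : ℕ} (u : Fin (n + 1) → ℤ) (S : ℤ) (v : Fin (n + 2) → ℤ) :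
    minForm (Fin.snoc (α := fun _ => ℤ) (u - S • partVec (n + 1) (n + 1)) S : Fin (n + 2) → ℤ) v
      = ∑ b, u b * minSum (b.val + 1) v + S * (minSum (n + 2) v - minSum (n + 1) v) := by
  have h := sum_mul_partVec (N := n + 1) (fun b => minSum b v) (minSum_zero_left v) le_rfl
  rw [minForm, Fin.sum_univ_castSucc]
  simp only [Fin.snoc_castSucc, Fin.snoc_last, Fin.val_castSucc, Fin.val_last, Pi.sub_apply,
    Pi.smul_apply, smul_eq_mul, sub_mul, Finset.sum_sub_distrib]
  have h' : ∑ b : Fin (n + 1), S * partVec (n + 1) (n + 1) b * minSum (b.val + 1) v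
      = S * minSum (n + 1) v := by
    rw [← h, Finset.mul_sum]
    exact Finset.sum_congr rfl fun b _ => by ring
  rw [h']
  ring

lemma minForm_merge_self {n : ℕ} (u : Fin (n + 1) → ℤ) (S : ℤ) :
    minForm (Fin.snoc (α := fun _ => ℤ) (u - S • partVec (n + 1) (n + 1)) S : Fin (n + 2) → ℤ)
      (Fin.snoc (α := fun _ => ℤ) (u - S • partVec (n + 1) (n + 1)) S : Fin (n + 2) → ℤ)
      = minForm u u + S ^ 2 := by
  rw [minForm_merge, minSum_top_merge, minSum_merge le_rfl, minForm,
    Finset.sum_congr rfl fun b _ => by rw [minSum_merge (by omega)]]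
  ring

lemma minForm_merge_snoc_zero {n : ℕ} (u L : Fin (n + 1) → ℤ) (S : ℤ) :
    minForm (Fin.snoc (α := fun _ => ℤ) (u - S • partVec (n + 1) (n + 1)) S : Fin (n + 2) → ℤ)
      (Fin.snoc (α := fun _ => ℤ) L 0 : Fin (n + 2) → ℤ) = minForm u L := by
  have h := minSum_succ_top L
  rw [minForm_merge, minSum_snoc, minSum_snoc, h, minForm,
    Finset.sum_congr rfl fun b _ => by rw [minSum_snoc, mul_zero, add_zero]]
  ring

lemma fermTerm_merge {q : ℂ} (hq0 : q ≠ 0) {n : ℕ} (L u : Fin (n + 1) → ℤ) (A S : ℤ) :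
    fermTerm q (Fin.snoc (α := fun _ => ℤ) L 0 : Fin (n + 2) → ℤ) A
      (Fin.snoc (α := fun _ => ℤ) (u - S • partVec (n + 1) (n + 1)) S : Fin (n + 2) → ℤ)
    = q ^ (minForm u u - minForm u L)
      * (∏ c : Fin n, qBin q (minSum (c.val + 1) (L - (2 : ℤ) • u) + u c.castSucc) (u c.castSucc))
      * (q ^ (S ^ 2) * qBin q ((minSum (n + 1) L - A - minSum (n + 1) u) + (A - minSum (n + 1) u)
          + u (Fin.last n) - S) (u (Fin.last n) - S)
        * (qBin q (A - minSum (n + 1) u) S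
          * qBin q (minSum (n + 1) L - A - minSum (n + 1) u) S)) := by
  have h := minSum_succ_top L
  have hp : ∀ a ≤ n + 1, minSum a ((Fin.snoc (α := fun _ => ℤ) L 0 : Fin (n + 2) → ℤ) - (2 : ℤ) •
      (Fin.snoc (α := fun _ => ℤ) (u - S • partVec (n + 1) (n + 1)) S : Fin (n + 2) → ℤ))
      = minSum a (L - (2 : ℤ) • u) := by
    intro a ha
    rw [map_sub, map_smul, minSum_merge ha, minSum_snoc, map_sub, map_smul]
    simp
  rw [fermTerm, minForm_merge_self, minForm_merge_snoc_zero, minSum_top_merge, minSum_snoc, h,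
    Fin.prod_univ_castSucc, hp _ (by simp), map_sub, map_smul]
  have e0 : q ^ (minForm u u + S ^ 2 - minForm u L) = q ^ (minForm u u - minForm u L) * q ^ (S ^ 2) := by
    rw [← zpow_add₀ hq0]; congr 1; ring
  have e1 : ∏ c : Fin n, qBin q (minSum (c.castSucc.val + 1)
      ((Fin.snoc (α := fun _ => ℤ) L 0 : Fin (n + 2) → ℤ) - (2 : ℤ) •
      (Fin.snoc (α := fun _ => ℤ) (u - S • partVec (n + 1) (n + 1)) S : Fin (n + 2) → ℤ))
      + (Fin.snoc (α := fun _ => ℤ) (u - S • partVec (n + 1) (n + 1)) S : Fin (n + 2) → ℤ)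
        c.castSucc.castSucc)
      ((Fin.snoc (α := fun _ => ℤ) (u - S • partVec (n + 1) (n + 1)) S : Fin (n + 2) → ℤ)
        c.castSucc.castSucc)
      = ∏ c : Fin n, qBin q (minSum (c.val + 1) (L - (2 : ℤ) • u) + u c.castSucc)
          (u c.castSucc) := by
    refine Finset.prod_congr rfl fun c _ => ?_
    have hc : partVec (n + 1) (n + 1) c.castSucc = 0 :=
      partVec_apply_of_ne (by have := c.isLt; simp; omega)
    rw [hp _ (by have := c.isLt; rw [Fin.val_castSucc]; omega), Fin.snoc_castSucc]
    simp [hc]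
  have e2 : partVec (n + 1) (n + 1) (Fin.last n) = 1 := by simp [partVec]
  rw [e0, e1]
  simp only [Fin.snoc_last, Fin.snoc_castSucc, Fin.val_last, Pi.sub_apply, Pi.smul_apply,
    smul_eq_mul, e2, mul_one, mul_zero, add_zero]
  rw [show S + (A - (minSum (n + 1) u + S)) = A - minSum (n + 1) u by ring,
    show S + (minSum (n + 1) L - A - (minSum (n + 1) u + S))
      = minSum (n + 1) L - A - minSum (n + 1) u by ring,
    show minSum (n + 1) L - 2 * minSum (n + 1) u + (u (Fin.last n) - S)
      = minSum (n + 1) L - A - minSum (n + 1) u + (A - minSum (n + 1) u) + u (Fin.last n) - S by ring]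
  ring

/-- With the total number of strings of the two largest lengths fixed, only the number S of longest
ones varies, and the sum over S is q-Pfaff–Saalschütz. -/
lemma fermSum_snoc_zero {q : ℂ} (hq0 : q ≠ 0) (hq1 : ‖q‖ < 1) {n : ℕ} (L : Fin (n + 1) → ℤ)
    (A : ℤ) : fermSum q (Fin.snoc (α := fun _ => ℤ) L 0 : Fin (n + 2) → ℤ) A = fermSum q L A := by
  have hfin : (Function.support fun x : (Fin (n + 1) → ℤ) × ℤ =>
      fermTerm q (Fin.snoc (α := fun _ => ℤ) L 0 : Fin (n + 2) → ℤ) A ((mergeEquiv n).symm x)).Finite :=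
    (fermTerm_finite q _ A).preimage (mergeEquiv n).symm.injective.injOn
  rw [fermSum, ← finsum_comp_equiv (mergeEquiv n).symm, finsum_curry _ hfin, fermSum]
  refine finsum_congr fun u => ?_
  refine (finsum_congr fun S => fermTerm_merge hq0 L u A S).trans ?_
  rw [← mul_finsum, q_saalschuetz_finsum hq0 hq1]
  rfl

lemma fermSum_one {q : ℂ} (hq0 : q ≠ 0) (hq1 : ‖q‖ < 1) (L : Fin 1 → ℤ) (A : ℤ) :
    fermSum q L A = q ^ (A ^ 2 - A * L 0) * qBin q (L 0) A := by
  have h : ∀ S : ℤ, fermTerm q L A ((Equiv.funUnique (Fin 1) ℤ).symm S)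
      = q ^ (S ^ 2 - S * L 0) * (qBin q A S * qBin q (L 0 - A) S) := by
    intro S
    simp [fermTerm, minForm, minSum_apply, Equiv.funUnique, pow_two]
  rw [fermSum, ← finsum_comp_equiv (Equiv.funUnique (Fin 1) ℤ).symm, finsum_congr h]
  by_cases h0 : 0 ≤ A ∧ A ≤ L 0
  · obtain ⟨hA, hAL⟩ := h0
    have hv := q_chu_vandermonde hq0 hq1 hA (L 0 - A).toNat (L 0 - A)
    rw [Int.toNat_of_nonneg (by omega), add_sub_cancel, qBin_symm] at hv
    rw [← hv, Finset.mul_sum, finsum_eq_sum_of_support_subset (s := Finset.Icc 0 A)]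
    · refine Finset.sum_congr rfl fun S _ => ?_
      have e : q ^ (S ^ 2 - S * L 0) = q ^ (A ^ 2 - A * L 0) * q ^ ((A - S) * (L 0 - A - S)) := by
        rw [← zpow_add₀ hq0]; congr 1; ring
      rw [e, qBin_symm]; ring
    · intro S hS
      have := nonneg_of_qBin_ne_zero (left_ne_zero_of_mul (right_ne_zero_of_mul hS))
      rw [Finset.coe_Icc, Set.mem_Icc]; exact this
  · have hz : ∀ S : ℤ, q ^ (S ^ 2 - S * L 0) * (qBin q A S * qBin q (L 0 - A) S) = 0 := by
      intro S
      by_contra hS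
      have h1 := nonneg_of_qBin_ne_zero (left_ne_zero_of_mul (right_ne_zero_of_mul hS))
      have h2 := nonneg_of_qBin_ne_zero (right_ne_zero_of_mul (right_ne_zero_of_mul hS))
      omega
    rw [finsum_congr hz, finsum_zero, qBin, if_neg (by omega), mul_zero]

/-! ### Fermionic sums as operator sequences. -/

lemma partVec_eq_snoc {n a : ℕ} (ha : a ≤ n + 1) :
    partVec (n + 2) a = Fin.snoc (α := fun _ => ℤ) (partVec (n + 1) a) 0 := by
  funext c
  refine Fin.lastCases ?_ (fun c => ?_) c
  · rw [Fin.snoc_last]; exact partVec_apply_of_ne (by simp; omega)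
  · rw [Fin.snoc_castSucc]; rfl

lemma partSeq_append_replicate_zero (q : ℂ) (Λ : List ℕ) (k : ℕ) :
    partSeq q (Λ ++ List.replicate k 0) = partSeq q Λ := by
  induction k with
  | zero => simp
  | succ k ih => rw [List.replicate_succ', ← List.append_assoc, partSeq_append_zero, ih]

/-- The fermionic sum for parts of the two sizes `n + 1`, `n` and one smaller part. -/
lemma fermSum_eq_partSeq {q : ℂ} (hq0 : q ≠ 0) (hq1 : ‖q‖ < 1) (n : ℕ) :
    ∀ (l k b : ℕ) (A : ℤ), b ≤ n →
    fermSum q ((l : ℤ) • partVec (n + 1) (n + 1) + (k : ℤ) • partVec (n + 1) n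
      + partVec (n + 1) b) A
    = partSeq q (List.replicate l (n + 1) ++ List.replicate k n ++ [b]) A := by
  induction n with
  | zero =>
    intro l k b A hb
    obtain rfl : b = 0 := by omega
    rw [fermSum_one hq0 hq1, partSeq_append_zero, partSeq_append_replicate_zero,
      partSeq_replicate hq0 hq1, nestedSum_one, ← mul_assoc, ← zpow_add₀ hq0]
    simp only [zero_add, partVec_zero, Pi.add_apply, Pi.smul_apply, Pi.zero_apply, smul_zero, add_zero]
    have : partVec 1 1 0 = 1 := rfl
    rw [this]
    simp only [smul_eq_mul, mul_one]
    congr 2; ring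
  | succ n ih =>
    intro l
    induction l with
    | zero =>
      -- Without parts n + 2 the rank drops by one, and the former parts n + 1 become the largest
      -- ones. A part b = n + 1 is counted among them.
      intro k b A hb
      have h : ((0 : ℕ) : ℤ) • partVec (n + 1 + 1) (n + 1 + 1) + (k : ℤ) • partVec (n + 1 + 1) (n + 1)
          + partVec (n + 1 + 1) b = (Fin.snoc (α := fun _ => ℤ) ((k : ℤ) • partVec (n + 1) (n + 1)
            + partVec (n + 1) b) 0 : Fin (n + 2) → ℤ) := by
        rw [partVec_eq_snoc le_rfl, partVec_eq_snoc hb]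
        funext c
        refine Fin.lastCases ?_ (fun c => ?_) c <;> simp
      rw [h, fermSum_snoc_zero hq0 hq1]
      rcases Nat.lt_or_ge n b with hb' | hb'
      · obtain rfl : b = n + 1 := by omega
        have := ih (k + 1) 0 0 A (by omega)
        rw [partSeq_append_zero] at this
        rw [List.replicate_zero, List.nil_append, ← List.replicate_succ']
        simpa [partVec_zero, add_smul] using this
      · have := ih k 0 b A hb'
        simpa using this
    | succ l ihl =>
      -- Both sides satisfy the exchange rule for the pair (n + 1, b + 1). It expresses a new part n
      -- + 2 next to b through two configurations with only l parts n + 2, known by the induction on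
      -- l.
      have key : ∀ (k b : ℕ) (A : ℤ), b ≤ n →
          fermSum q (((l + 1 : ℕ) : ℤ) • partVec (n + 1 + 1) (n + 1 + 1)
            + (k : ℤ) • partVec (n + 1 + 1) (n + 1) + partVec (n + 1 + 1) b) A
          = partSeq q (List.replicate (l + 1) (n + 1 + 1) ++ List.replicate k (n + 1) ++ [b]) A := by
        intro k b A hb
        set e := partVec (n + 1 + 1) with he
        have hG := fermSum_pair hq0 hq1 (n := n + 1) (n + 1) (b + 1) (by omega) (by omega) le_rfl
          ((l : ℤ) • e (n + 1 + 1) + (k : ℤ) • e (n + 1))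
          (fun c hc => by
            simp only [Pi.add_apply, Pi.smul_apply, he]
            rw [partVec_apply_of_ne (by omega), partVec_apply_of_ne (by omega)]; simp)
          (fun c hc => by
            have h0 : partVec (n + 1 + 1) (n + 1) c = 1 := if_pos hc
            simp only [Pi.add_apply, Pi.smul_apply, he]
            rw [h0, partVec_apply_of_ne (by omega)]; simp) A
        have hsum : ∑ c, ((l : ℤ) • e (n + 1 + 1) + (k : ℤ) • e (n + 1)) c = l + k := by
          simp only [Pi.add_apply, Pi.smul_apply, smul_eq_mul, Finset.sum_add_distrib,
            ← Finset.mul_sum]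
          rw [sum_partVec (by omega) le_rfl, sum_partVec (by omega) (by omega)]; ring
        have i1 := ihl (k + 1) (b + 1) A (by omega)
        have i2 := ihl k (n + 1 - (b + 1)) (A - (b + 1 : ℕ)) (by omega)
        have hS := partSeq_append_pair hq0 (a := n + 1) (b := b) (by omega)
          (List.replicate l (n + 1 + 1) ++ List.replicate k (n + 1)) A
        have m1 : (l : ℤ) • e (n + 1 + 1) + ((k + 1 : ℕ) : ℤ) • e (n + 1) + e (b + 1)
            = (l : ℤ) • e (n + 1 + 1) + (k : ℤ) • e (n + 1) + e (n + 1) + e (b + 1) := by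
          push_cast; rw [add_smul, one_smul]; abel
        have m2 : ((l + 1 : ℕ) : ℤ) • e (n + 1 + 1) + (k : ℤ) • e (n + 1) + e b
            = (l : ℤ) • e (n + 1 + 1) + (k : ℤ) • e (n + 1) + e (n + 1 + 1) + e (b + 1 - 1) := by
          rw [add_tsub_cancel_right]
          push_cast; rw [add_smul, one_smul]; abel
        have m3 : List.replicate l (n + 1 + 1) ++ List.replicate (k + 1) (n + 1) ++ [b + 1]
            = List.replicate l (n + 1 + 1) ++ List.replicate k (n + 1) ++ [n + 1, b + 1] := by
          rw [List.replicate_succ']; simp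
        -- The exchange rule creates the new part n + 2 behind the block of parts n + 1; commuting
        -- neighbouring sizes moves it to the front.
        have m4 : partSeq q (List.replicate (l + 1) (n + 1 + 1) ++ List.replicate k (n + 1) ++ [b])
            = partSeq q (List.replicate l (n + 1 + 1) ++ List.replicate k (n + 1)
              ++ [n + 1 + 1, b]) := by
          have := partSeq_append_congr (q := q) (List.replicate l (n + 1 + 1)) (by simp; ring)
            (partSeq_cons_replicate hq0 (n + 1) k [b])
          rw [List.replicate_succ']
          simpa using this
        rw [m1, m3] at i1
        rw [i1, hsum, i2, ← m2] at hG
        rw [m4]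
        simp only [List.length_append, List.length_replicate] at hS
        push_cast at hG hS ⊢
        linear_combination hS - hG
      intro k b A hb
      rcases Nat.lt_or_ge n b with hb' | hb'
      · obtain rfl : b = n + 1 := by omega
        have := key (k + 1) 0 A (by omega)
        rw [partSeq_append_zero, List.replicate_succ' (n := k), ← List.append_assoc] at this
        rw [← this]
        congr 1
        rw [partVec_zero, add_zero, Nat.cast_add k 1, Nat.cast_one, add_smul (k : ℤ) 1, one_smul]
        abel
      · exact key k b A hb'

/-- The fermionic sum for `L` copies of the top spin is a `q`-multinomial sum. -/
theorem fermSum_top {q : ℂ} (hq0 : q ≠ 0) (hq1 : ‖q‖ < 1) (n L : ℕ) (A : ℤ) :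
    fermSum q ((L : ℤ) • partVec (n + 1) (n + 1)) A
      = q ^ (-(L * A)) * nestedSum q (n + 1) L A := by
  have h := fermSum_eq_partSeq hq0 hq1 n L 0 0 A (Nat.zero_le n)
  rw [partSeq_append_zero] at h
  rw [← partSeq_replicate hq0 hq1]
  simpa [partVec_zero] using h

/-! ### The inverse Cartan matrix. -/

lemma sum_fin_ite_val {R : Type*} [AddCommMonoid R] (M j : ℕ) (g : ℕ → R) :
    ∑ k : Fin M, (if k.val = j then g k.val else 0) = if j < M then g j else 0 := by
  split_ifs with h
  · rw [Finset.sum_eq_single (⟨j, h⟩ : Fin M)]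
    · simp
    · intro k _ hk
      exact if_neg fun h' => hk (Fin.ext h')
    · simp
  · refine Finset.sum_eq_zero fun k _ => if_neg ?_
    have := k.isLt
    omega

/-- C is minus the second difference. The right boundary value is assumed zero; f 0 does not occur
in the sum, so it is added back in the first row. This source term later yields the e₁ of the (m,
n)-system. -/
lemma cartan_mul_sum {R : Type*} [CommRing R] (N : ℕ) (f : ℕ → R) (hN : f N = 0)
    (i : Fin (N - 1)) :
    ∑ k, (cartan N i k : R) * f (k.val + 1)
      = 2 * f (i.val + 1) - f i.val - f (i.val + 2) + if i.val = 0 then f 0 else 0 := by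
  have h : ∀ k : Fin (N - 1), (cartan N i k : R) * f (k.val + 1)
      = (if k.val = i.val then 2 * f (k.val + 1) else 0)
        - (if k.val = i.val + 1 then f (k.val + 1) else 0)
        - (if k.val = i.val - 1 then (if i.val = 0 then 0 else f (k.val + 1)) else 0) := by
    intro k
    simp only [cartan, Matrix.of_apply, Fin.ext_iff]
    split_ifs <;> first | (exfalso; omega) | simp
  have hi := i.isLt
  rw [Finset.sum_congr rfl fun k _ => h k, Finset.sum_sub_distrib, Finset.sum_sub_distrib,
    sum_fin_ite_val (N - 1) i.val fun k => 2 * f (k + 1),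
    sum_fin_ite_val (N - 1) (i.val + 1) fun k => f (k + 1),
    sum_fin_ite_val (N - 1) (i.val - 1) fun k => if i.val = 0 then 0 else f (k + 1),
    if_pos hi, if_pos (show i.val - 1 < N - 1 by omega)]
  have h2 : (if i.val + 1 < N - 1 then f (i.val + 1 + 1) else 0) = f (i.val + 2) := by
    split_ifs with h2
    · rfl
    · rw [show i.val + 2 = N by omega, hN]
  rw [h2]
  by_cases h3 : i.val = 0
  · rw [if_pos h3, if_pos h3, h3]; ring
  · rw [if_neg h3, if_neg h3, Nat.sub_add_cancel (Nat.one_le_iff_ne_zero.mpr h3)]; ring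

lemma cartan_mul_inverse {N : ℕ} (hN : 1 ≤ N) :
    (cartan N).map (fun x : ℤ => (x : ℚ)) * (Matrix.of fun i j : Fin (N - 1) =>
      ((min (i.val + 1) (j.val + 1) : ℕ) : ℚ) - (i.val + 1) * (j.val + 1) / N) = 1 := by
  ext i j
  have hj := j.isLt
  have hi := i.isLt
  have hN0 : (N : ℚ) ≠ 0 := by positivity
  have h := cartan_mul_sum N (fun x : ℕ => ((min x (j.val + 1) : ℕ) : ℚ) - x * (j.val + 1) / N)
    (by rw [min_eq_right (by omega)]; field_simp; push_cast; ring) i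
  rw [Matrix.mul_apply]
  simp only [Matrix.map_apply, Matrix.of_apply]
  push_cast at h ⊢
  rw [h, Matrix.one_apply]
  simp only [zero_mul, zero_div]
  have hz : (if i.val = 0 then min (0 : ℚ) (j.val + 1) - 0 else 0) = 0 := by
    split_ifs
    · rw [min_eq_left (by positivity)]; ring
    · rfl
  rw [hz]
  rcases lt_trichotomy i.val j.val with hij | hij | hij
  · have : (i.val : ℚ) + 1 ≤ j.val := by exact_mod_cast hij
    rw [if_neg (fun h => by rw [h] at hij; exact lt_irrefl _ hij), min_eq_left (by linarith),
      min_eq_left (by linarith), min_eq_left (by linarith)]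
    ring
  · have : (i.val : ℚ) = j.val := by exact_mod_cast hij
    rw [if_pos (Fin.ext hij), this, min_self, min_eq_left (by linarith), min_eq_right (by linarith)]
    ring
  · have : (j.val : ℚ) + 1 ≤ i.val := by exact_mod_cast hij
    rw [if_neg (fun h => by rw [h] at hij; exact lt_irrefl _ hij), min_eq_right (by linarith),
      min_eq_right (by linarith), min_eq_right (by linarith)]
    ring

lemma cartanInv_eq {N : ℕ} (hN : 1 ≤ N) :
    cartanInv N = Matrix.of fun i j : Fin (N - 1) =>
      ((min (i.val + 1) (j.val + 1) : ℕ) : ℚ) - (i.val + 1) * (j.val + 1) / N :=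
  Matrix.inv_eq_right_inv (cartan_mul_inverse hN)

lemma cartan_mulVec_injective {N : ℕ} (hN : 1 ≤ N) {m m' : Vec N}
    (h : cartan N *ᵥ m = cartan N *ᵥ m') : m = m' := by
  have h1 := mul_eq_one_comm.mp (cartan_mul_inverse hN)
  have h2 : ∀ v : Vec N, (cartan N).map (fun x : ℤ => (x : ℚ)) *ᵥ (fun j => (v j : ℚ))
      = fun j => (((cartan N *ᵥ v) j : ℤ) : ℚ) := by
    intro v
    funext j
    simp [Matrix.mulVec, dotProduct]
  have h3 : (fun j => (m j : ℚ)) = fun j => (m' j : ℚ) := by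
    rw [← Matrix.one_mulVec (fun j => (m j : ℚ)), ← Matrix.one_mulVec (fun j => (m' j : ℚ)), ← h1,
      ← Matrix.mulVec_mulVec, ← Matrix.mulVec_mulVec, h2, h2, h]
  funext j
  exact_mod_cast congrFun h3 j

lemma minSum_top_apply {n : ℕ} (v : Fin n → ℤ) : minSum (n + 1) v = ∑ b, ((b.val : ℤ) + 1) * v b := by
  rw [minSum_apply]
  refine Finset.sum_congr rfl fun b _ => ?_
  have := b.isLt
  rw [min_eq_right (by omega)]
  push_cast; rfl

lemma form_eq {n : ℕ} (u v : Fin n → ℤ) :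
    form (n + 1) u v = minForm u v - (minSum (n + 1) u : ℚ) * minSum (n + 1) v / (n + 1) := by
  rw [form, cartanInv_eq (by omega), minSum_top_apply, minSum_top_apply]
  change ∑ i : Fin n, (u i : ℚ) * ∑ j : Fin n, (((min (i.val + 1) (j.val + 1) : ℕ) : ℚ)
    - (i.val + 1) * (j.val + 1) / ((n + 1 : ℕ) : ℚ)) * (v j : ℚ) = _
  simp only [minForm, minSum_apply]
  push_cast
  rw [Finset.sum_mul, Finset.sum_div, ← Finset.sum_sub_distrib]
  refine Finset.sum_congr rfl fun i _ => ?_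
  rw [Finset.mul_sum, Finset.mul_sum, Finset.mul_sum, Finset.sum_div, ← Finset.sum_sub_distrib]
  exact Finset.sum_congr rfl fun j _ => by ring

lemma form_unitVec_one {n : ℕ} (v : Fin n → ℤ) :
    form (n + 1) (unitVec (n + 1) 1) v = (∑ c, v c : ℤ) - (minSum (n + 1) v : ℚ) / (n + 1) := by
  rw [show unitVec (n + 1) 1 = partVec n 1 from rfl, form_eq]
  rcases Nat.eq_zero_or_pos n with rfl | hn
  · simp [minForm, minSum_apply]
  · rw [minForm_partVec_left hn, minSum_partVec _ hn, minSum_of_support (by omega),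
      min_eq_right (by omega)]
    push_cast; ring

lemma form_unitVec_last {n : ℕ} (v : Fin n → ℤ) :
    form (n + 1) (unitVec (n + 1) (n + 1 - 1)) v = (minSum (n + 1) v : ℚ) / (n + 1) := by
  rw [show unitVec (n + 1) (n + 1 - 1) = partVec n n from rfl, form_eq,
    minForm_partVec_left le_rfl, minSum_partVec _ le_rfl, minSum_succ_top, min_eq_right (by omega)]
  push_cast
  have : (n : ℚ) + 1 ≠ 0 := by positivity
  field_simp
  ring

lemma minSum_init {n : ℕ} (a : ℕ) (ν : Fin (n + 1) → ℤ) :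
    minSum a ν = minSum a (fun c : Fin n => ν c.castSucc) + (min a (n + 1) : ℕ) * ν (Fin.last n) := by
  rw [minSum_apply, Fin.sum_univ_castSucc]
  rfl

lemma minForm_init {n : ℕ} (ν : Fin (n + 1) → ℤ) :
    minForm ν ν = minForm (fun c : Fin n => ν c.castSucc) (fun c : Fin n => ν c.castSucc)
      + 2 * ν (Fin.last n) * minSum (n + 1) (fun c : Fin n => ν c.castSucc)
      + (n + 1) * ν (Fin.last n) ^ 2 := by
  have h : ∀ c : Fin n, ν c.castSucc * minSum (c.castSucc.val + 1) ν
      = ν c.castSucc * minSum (c.val + 1) (fun c : Fin n => ν c.castSucc)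
        + ν (Fin.last n) * (((c.val : ℤ) + 1) * ν c.castSucc) := by
    intro c
    have := c.isLt
    rw [minSum_init, Fin.val_castSucc, min_eq_left (by omega)]
    push_cast; ring
  rw [minForm, Fin.sum_univ_castSucc, Finset.sum_congr rfl fun c _ => h c, Finset.sum_add_distrib,
    ← Finset.mul_sum, ← minSum_top_apply, Fin.val_last, minSum_init, min_self, minForm]
  push_cast; ring

/-- The last unit vector lies in the radical of min(i, j) - ij/N on N coordinates, so dropping the
last entry does not change the form. -/
lemma form_init {n : ℕ} (ν : Fin (n + 1) → ℤ) :
    form (n + 1) (fun c : Fin n => ν c.castSucc) (fun c : Fin n => ν c.castSucc)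
      = minForm ν ν - (minSum (n + 1) ν : ℚ) ^ 2 / (n + 1) := by
  rw [form_eq, minForm_init, minSum_init (n + 1) ν, min_self]
  have : (n : ℚ) + 1 ≠ 0 := by positivity
  push_cast
  field_simp
  ring

lemma minSum_top_rev {n : ℕ} (v : Fin n → ℤ) :
    minSum (n + 1) (fun c => v (Fin.rev c)) = (n + 1) * ∑ c, v c - minSum (n + 1) v := by
  rw [minSum_top_apply, minSum_top_apply, Finset.mul_sum, ← Finset.sum_sub_distrib,
    ← Equiv.sum_comp Fin.revPerm]
  refine Finset.sum_congr rfl fun c _ => ?_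
  have h : ((n - (c.val + 1) : ℕ) : ℤ) = n - (c.val + 1) := by have := c.isLt; omega
  simp only [Fin.revPerm_apply, Fin.rev_rev, Fin.val_rev]
  rw [h]
  ring

lemma minForm_rev {n : ℕ} (v : Fin n → ℤ) :
    minForm (fun c => v (Fin.rev c)) (fun c => v (Fin.rev c))
      = minForm v v + (n + 1) * (∑ c, v c) ^ 2 - 2 * (∑ c, v c) * minSum (n + 1) v := by
  have h : ∀ b : Fin n, v b * minSum ((Fin.rev b).val + 1) (fun c => v (Fin.rev c))
      = v b * minSum (b.val + 1) v + (n + 1) * (∑ c, v c) * v b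
        - (∑ c, v c) * ((b.val + 1) * v b) - minSum (n + 1) v * v b := by
    intro b
    have hb : minSum ((Fin.rev b).val + 1) (fun c => v (Fin.rev c))
        = minSum (b.val + 1) v + (n + 1) * (∑ c, v c)
        - (∑ c, v c) * (b.val + 1) - minSum (n + 1) v := by
      rw [minSum_apply, minSum_apply, minSum_top_apply, ← Equiv.sum_comp Fin.revPerm,
        Finset.mul_sum, Finset.sum_mul, ← Finset.sum_add_distrib, ← Finset.sum_sub_distrib,
        ← Finset.sum_sub_distrib]
      refine Finset.sum_congr rfl fun c _ => ?_
      have h1 := b.isLt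
      have h2 := c.isLt
      simp only [Fin.revPerm_apply, Fin.rev_rev, Fin.val_rev]
      rcases le_total b.val c.val with h | h
      · rw [min_eq_right (by omega), min_eq_left (by omega)]
        push_cast [Nat.cast_sub (show c.val + 1 ≤ n from h2)]; ring
      · rw [min_eq_left (by omega), min_eq_right (by omega)]
        push_cast [Nat.cast_sub (show b.val + 1 ≤ n from h1)]; ring
    rw [hb]; ring
  rw [minForm, ← Equiv.sum_comp Fin.revPerm]
  simp only [Fin.revPerm_apply, Fin.rev_rev]
  rw [Finset.sum_congr rfl fun b _ => h b, Finset.sum_sub_distrib, Finset.sum_sub_distrib,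
    Finset.sum_add_distrib, ← Finset.mul_sum, ← Finset.mul_sum, ← Finset.mul_sum,
    ← minSum_top_apply, minForm]
  ring

/-- The diagram symmetry i ↦ N - i preserves min(i, j) - ij/N. It is needed because `stringData`
lists the strings from the longest down. -/
lemma form_rev {n : ℕ} (v : Fin n → ℤ) :
    form (n + 1) (fun c : Fin n => v (Fin.rev c)) (fun c : Fin n => v (Fin.rev c))
      = form (n + 1) v v := by
  rw [form_eq, form_eq, minForm_rev, minSum_top_rev]
  have : (n : ℚ) + 1 ≠ 0 := by positivity
  push_cast
  field_simp
  ring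

/-! ### The q-multinomial coefficient as a nested sum. -/

lemma cpow_ratCast_add {q : ℂ} (hq0 : q ≠ 0) (r s : ℚ) :
    q ^ ((r + s : ℚ) : ℂ) = q ^ ((r : ℚ) : ℂ) * q ^ ((s : ℚ) : ℂ) := by
  rw [Rat.cast_add, Complex.cpow_add _ _ hq0]

lemma cpow_ratCast_intCast (q : ℂ) (z : ℤ) : q ^ (((z : ℤ) : ℚ) : ℂ) = q ^ z := by
  rw [Rat.cast_intCast, Complex.cpow_intCast]

/-- The summand of the `q`-multinomial coefficient in terms of the multiplicities `κ` of the
parts `1, …, N`. -/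
def multinomTerm (q : ℂ) {N : ℕ} (L : ℤ) (κ : Fin N → ℤ) : ℂ :=
  q ^ minForm κ κ * qPoch q L.toNat * qPochInv q (L - ∑ c, κ c) * ∏ c, qPochInv q (κ c)

lemma nonneg_of_qPochInv_ne_zero {q : ℂ} {k : ℤ} (h : qPochInv q k ≠ 0) : 0 ≤ k := by
  by_contra h'
  exact h (qPochInv_of_neg q (by omega))

lemma multinomTerm_support {q : ℂ} {N : ℕ} {L : ℤ} {κ : Fin N → ℤ} (h : multinomTerm q L κ ≠ 0) :
    (∀ c, 0 ≤ κ c) ∧ ∑ c, κ c ≤ L := by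
  refine ⟨fun c => nonneg_of_qPochInv_ne_zero
    (Finset.prod_ne_zero_iff.mp (right_ne_zero_of_mul h) c (Finset.mem_univ c)), ?_⟩
  have := nonneg_of_qPochInv_ne_zero (right_ne_zero_of_mul (left_ne_zero_of_mul h))
  omega

lemma multinomTerm_finite (q : ℂ) {N : ℕ} (L : ℤ) :
    (Function.support (multinomTerm q L : (Fin N → ℤ) → ℂ)).Finite := by
  refine (Set.finite_Icc (0 : Fin N → ℤ) fun _ => L).subset fun κ hκ => ?_
  obtain ⟨h1, h2⟩ := multinomTerm_support hκ
  exact ⟨h1, fun c => (Finset.single_le_sum (fun c _ => h1 c) (Finset.mem_univ c)).trans h2⟩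

/-- Splitting off the total number of parts. -/
def countEquiv (N : ℕ) : (Fin (N + 1) → ℤ) ≃ ℤ × (Fin N → ℤ) where
  toFun κ := (∑ c, κ c, fun c => κ c.succ)
  invFun x := Fin.cons (α := fun _ => ℤ) (x.1 - ∑ c, x.2 c) x.2
  left_inv κ := by
    funext c
    refine Fin.cases ?_ (fun c => ?_) c <;> simp [Fin.sum_univ_succ]
  right_inv x := by
    refine Prod.ext ?_ (funext fun c => ?_) <;> simp [Fin.sum_univ_succ]

lemma sum_count {N : ℕ} (P : ℤ) (κ : Fin N → ℤ) :
    ∑ c, (Fin.cons (α := fun _ => ℤ) (P - ∑ c, κ c) κ : Fin (N + 1) → ℤ) c = P := by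
  simp [Fin.sum_univ_succ]

lemma minSum_count {N : ℕ} (a : ℕ) (P : ℤ) (κ : Fin N → ℤ) :
    minSum (a + 1) (Fin.cons (α := fun _ => ℤ) (P - ∑ c, κ c) κ : Fin (N + 1) → ℤ)
      = P + minSum a κ := by
  have h : ∀ c : Fin N, ((min (a + 1) (c.succ.val + 1) : ℕ) : ℤ) * κ c
      = κ c + ((min a (c.val + 1) : ℕ) : ℤ) * κ c := by
    intro c
    rw [Fin.val_succ, Nat.add_min_add_right]
    push_cast; ring
  rw [minSum_apply, Fin.sum_univ_succ]
  simp only [Fin.cons_zero, Fin.cons_succ]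
  rw [Finset.sum_congr rfl fun c _ => h c, Finset.sum_add_distrib, minSum_apply,
    min_eq_right (by simp)]
  simp only [Fin.val_zero, zero_add, Nat.cast_one, one_mul]
  ring

/-- Lowering every part by one removes the first column, of height P, and contributes P². Iterating
this turns the quadratic form of the multiplicities into P₁² + ⋯ + P_N². -/
lemma minForm_count {N : ℕ} (P : ℤ) (κ : Fin N → ℤ) :
    minForm (Fin.cons (α := fun _ => ℤ) (P - ∑ c, κ c) κ : Fin (N + 1) → ℤ)
      (Fin.cons (α := fun _ => ℤ) (P - ∑ c, κ c) κ : Fin (N + 1) → ℤ)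
      = P ^ 2 + minForm κ κ := by
  rw [minForm, Finset.sum_congr rfl fun b _ => by rw [minSum_count], Fin.sum_univ_succ]
  simp only [Fin.cons_zero, Fin.cons_succ, Fin.val_succ, mul_add, Finset.sum_add_distrib,
    ← Finset.sum_mul]
  rw [Fin.val_zero, minSum_zero_left, minForm]
  ring

lemma multinomTerm_count {q : ℂ} (hq0 : q ≠ 0) (hq1 : ‖q‖ < 1) {N : ℕ} (L P : ℤ)
    (κ : Fin N → ℤ) :
    multinomTerm q L (Fin.cons (α := fun _ => ℤ) (P - ∑ c, κ c) κ : Fin (N + 1) → ℤ)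
      = q ^ (P ^ 2) * qBin q L P * multinomTerm q P κ := by
  rw [multinomTerm, multinomTerm, minForm_count, sum_count, Fin.prod_univ_succ, zpow_add₀ hq0,
    qBin_eq]
  simp only [Fin.cons_zero, Fin.cons_succ]
  -- For P < 0 the factor (q)_P is only a default value, but then some multiplicity is negative and
  -- both sides vanish.
  rcases lt_or_ge P 0 with hP | hP
  · by_cases h : (∏ c, qPochInv q (κ c)) = 0
    · rw [h]; ring
    · have h1 : ∀ c, 0 ≤ κ c := fun c => nonneg_of_qPochInv_ne_zero
        (Finset.prod_ne_zero_iff.mp h c (Finset.mem_univ c))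
      have h2 : 0 ≤ ∑ c, κ c := Finset.sum_nonneg fun c _ => h1 c
      rw [qPochInv_of_neg q (show P - ∑ c, κ c < 0 by omega)]; ring
  · have h : qPochInv q P * qPoch q P.toNat = 1 := by
      rw [qPochInv_of_nonneg q hP]
      exact inv_mul_cancel₀ (qPoch_ne_zero hq1 _)
    linear_combination (-1 : ℂ) * q ^ (P ^ 2) * q ^ minForm κ κ * qPoch q L.toNat
      * qPochInv q (L - P) * qPochInv q (P - ∑ c, κ c) * (∏ c, qPochInv q (κ c)) * h

lemma nestedSum_eq_finsum_ite {q : ℂ} (hq0 : q ≠ 0) (hq1 : ‖q‖ < 1) (N : ℕ) :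
    ∀ (L : ℕ) (A : ℤ), nestedSum q N L A
      = ∑ᶠ κ : Fin N → ℤ, if minSum N κ = A then multinomTerm q L κ else 0 := by
  induction N with
  | zero =>
    intro L A
    rw [finsum_unique]
    have h := qPoch_ne_zero hq1 L
    simp only [minSum_zero_left, nestedSum, multinomTerm, minForm, Finset.univ_eq_empty,
      Finset.sum_empty, Finset.prod_empty, sub_zero, zpow_zero, one_mul, mul_one,
      qPochInv_of_nonneg q (Int.natCast_nonneg L), Int.toNat_natCast, mul_inv_cancel₀ h,
      eq_comm]
  | succ N ih =>
    intro L A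
    have hfin : (Function.support fun x : ℤ × (Fin N → ℤ) =>
        if minSum (N + 1) ((countEquiv N).symm x) = A then
          multinomTerm q L ((countEquiv N).symm x) else 0).Finite :=
      ((multinomTerm_finite q (L : ℤ)).preimage (countEquiv N).symm.injective.injOn).subset
        fun x hx => by
          rw [Function.mem_support, ne_eq, ite_eq_right_iff, Classical.not_imp] at hx
          exact hx.2
    have h : ∀ P : ℤ, ∑ᶠ κ : Fin N → ℤ, (if minSum (N + 1) ((countEquiv N).symm (P, κ)) = A then
          multinomTerm q L ((countEquiv N).symm (P, κ)) else 0)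
        = q ^ (P ^ 2) * qBin q L P * ∑ᶠ κ : Fin N → ℤ,
          if minSum N κ = A - P then multinomTerm q P κ else 0 := by
      intro P
      rw [mul_finsum]
      refine finsum_congr fun κ => ?_
      change (if minSum (N + 1) (Fin.cons (α := fun _ => ℤ) (P - ∑ c, κ c) κ : Fin (N + 1) → ℤ) = A
        then multinomTerm q L (Fin.cons (α := fun _ => ℤ) (P - ∑ c, κ c) κ : Fin (N + 1) → ℤ)
        else 0) = _
      rw [minSum_count, multinomTerm_count hq0 hq1, mul_ite, mul_zero]
      exact if_congr (by omega) rfl rfl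
    rw [← finsum_comp_equiv (countEquiv N).symm, finsum_curry _ hfin, finsum_congr h,
      finsum_int_eq_sum_range (T := L), nestedSum]
    · exact Finset.sum_congr rfl fun P _ => by rw [ih]
    · intro P hP
      exact nonneg_of_qBin_ne_zero (right_ne_zero_of_mul (left_ne_zero_of_mul hP))

lemma nestedSum_eq_finsum {q : ℂ} (hq0 : q ≠ 0) (hq1 : ‖q‖ < 1) (N L : ℕ) (A : ℤ) :
    nestedSum q N L A = ∑ᶠ κ ∈ {κ : Fin N → ℤ | minSum N κ = A}, multinomTerm q L κ := by
  rw [nestedSum_eq_finsum_ite hq0 hq1]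
  exact finsum_congr fun κ => (finsum_eq_if).symm

lemma multTerm_init {q : ℂ} (hq0 : q ≠ 0) {n L : ℕ} {l A : ℤ} (hA : 2 * A = (n + 1) * L + l)
    {κ : Fin (n + 1) → ℤ} (hκ : minSum (n + 1) κ = A) :
    multTerm q (n + 1) 0 L ((l : ℚ) / 2) (fun c : Fin n => κ c.castSucc)
      = q ^ ((-((A : ℚ) ^ 2 / (n + 1)) : ℚ) : ℂ) * multinomTerm q L κ := by
  have hn : (n : ℚ) + 1 ≠ 0 := by positivity
  have hAq : 2 * (A : ℚ) = (n + 1) * L + l := by exact_mod_cast hA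
  have hl : (l : ℚ) = 2 * A - (n + 1) * L := by linarith
  have hu : unitVec (n + 1) 0 = 0 := by funext j; simp [unitVec]
  have hw : (A : ℚ) = minSum (n + 1) (fun c : Fin n => κ c.castSucc) + (n + 1) * κ (Fin.last n) := by
    rw [minSum_init, min_self] at hκ
    rw [← hκ]; push_cast; ring
  have f1 : (L : ℚ) / 2 - (l : ℚ) / 2 / ((n + 1 : ℕ) : ℚ)
      - form (n + 1) (unitVec (n + 1) 1) (fun c : Fin n => κ c.castSucc)
      = ((L - ∑ c, κ c : ℤ) : ℚ) := by
    rw [form_unitVec_one, hl, Fin.sum_univ_castSucc, hw]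
    push_cast
    field_simp
    ring
  have f2 : (L : ℚ) / 2 + (l : ℚ) / 2 / ((n + 1 : ℕ) : ℚ)
      - form (n + 1) (unitVec (n + 1) (n + 1 - 1)) (fun c : Fin n => κ c.castSucc)
      = ((κ (Fin.last n) : ℤ) : ℚ) := by
    rw [form_unitVec_last, hl, hw]
    push_cast
    field_simp
    ring
  rw [multTerm, f1, f2, Int.floor_intCast, Int.floor_intCast, hu, sub_zero, form_init, hκ,
    sub_eq_add_neg, add_comm, cpow_ratCast_add hq0, cpow_ratCast_intCast, multinomTerm,
    Fin.prod_univ_castSucc, Int.toNat_natCast]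
  change _ * (∏ c : Fin n, qPochInv q (κ c.castSucc)) = _
  ring

/-- The integrality condition on η says that the last multiplicity, which is forced by the total
size A, is an integer. -/
lemma init_bijOn_multIndex {n L : ℕ} {l A : ℤ} (hA : 2 * A = (n + 1) * L + l) :
    Set.BijOn (fun (κ : Fin (n + 1) → ℤ) => ((fun c : Fin n => κ c.castSucc) : Vec (n + 1)))
      {κ | minSum (n + 1) κ = A} (multIndex (n + 1) L ((l : ℚ) / 2)) := by
  have hn : (n : ℚ) + 1 ≠ 0 := by positivity
  have hAq : 2 * (A : ℚ) = (n + 1) * L + l := by exact_mod_cast hA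
  have hl : (l : ℚ) = 2 * A - (n + 1) * L := by linarith
  have hform : ∀ v : Fin n → ℤ, (L : ℚ) / 2 + (l : ℚ) / 2 / ((n + 1 : ℕ) : ℚ)
      + form (n + 1) (unitVec (n + 1) 1) v
      = (A - minSum (n + 1) v) / (n + 1) + (∑ c, v c : ℤ) := by
    intro v
    rw [form_unitVec_one, hl]
    push_cast
    field_simp
    ring
  refine ⟨fun κ hκ => ?_, fun κ hκ κ' hκ' h => ?_, fun η hη => ?_⟩
  · refine ⟨κ (Fin.last n) + ∑ c : Fin n, κ c.castSucc, ?_⟩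
    rw [hform, ← (hκ : minSum (n + 1) κ = A), minSum_init (n + 1) κ, min_self]
    push_cast
    field_simp
    ring
  · have h1 := (hκ : minSum (n + 1) κ = A).trans (hκ' : minSum (n + 1) κ' = A).symm
    have h' : (fun c : Fin n => κ c.castSucc) = fun c : Fin n => κ' c.castSucc := h
    rw [minSum_init, minSum_init (n + 1) κ', h', min_self] at h1
    have h2 : κ (Fin.last n) = κ' (Fin.last n) :=
      mul_left_cancel₀ (by positivity : ((n + 1 : ℕ) : ℤ) ≠ 0) (add_left_cancel h1)
    funext c
    refine Fin.lastCases h2 (fun c => congrFun h' c) c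
  · obtain ⟨z, hz⟩ := hη
    have hη' : ((fun c : Fin n => η c) : Fin n → ℤ) = η := rfl
    rw [hform η] at hz
    refine ⟨Fin.snoc (α := fun _ => ℤ) (η : Fin n → ℤ) (z - ∑ c : Fin n, η c), ?_, ?_⟩
    · change minSum (n + 1) _ = A
      rw [minSum_init, min_self]
      simp only [Fin.snoc_castSucc, Fin.snoc_last]
      have : (A : ℚ) = minSum (n + 1) (fun c : Fin n => η c)
          + (n + 1) * (z - (∑ c : Fin n, η c : ℤ)) := by
        rw [← hz]
        field_simp
        ring
      have h2 : A = minSum (n + 1) (fun c : Fin n => η c) + (n + 1) * (z - ∑ c : Fin n, η c) := by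
        exact_mod_cast this
      rw [h2]; push_cast; rfl
    · funext c
      exact Fin.snoc_castSucc (α := fun _ => ℤ) (z - ∑ c : Fin n, η c) (η : Fin n → ℤ) c

theorem T_eq_nestedSum {q : ℂ} (hq0 : q ≠ 0) (hq1 : ‖q‖ < 1) {n L : ℕ} {l A : ℤ}
    (hA : 2 * A = (n + 1) * L + l) :
    T q (n + 1) 0 L ((l : ℚ) / 2)
      = q ^ ((-((A : ℚ) ^ 2 / (n + 1)) : ℚ) : ℂ) * nestedSum q (n + 1) L A := by
  rw [T, nestedSum_eq_finsum hq0 hq1, mul_finsum]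
  refine (finsum_mem_eq_of_bijOn (g := multTerm q (n + 1) 0 L ((l : ℚ) / 2)) _
    (init_bijOn_multIndex hA) fun κ _ => rfl).symm.trans
      (finsum_congr fun (κ : Fin (n + 1) → ℤ) => ?_)
  change (∑ᶠ (_ : minSum (n + 1) κ = A), multTerm q (n + 1) 0 L ((l : ℚ) / 2)
    (fun c : Fin n => κ c.castSucc)) = _ * ∑ᶠ (_ : minSum (n + 1) κ = A), multinomTerm q L κ
  rw [finsum_eq_if, finsum_eq_if, mul_ite, mul_zero]
  split_ifs with hκ
  · exact multTerm_init hq0 hA hκ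
  · rfl

lemma multTerm_support_finite {q : ℂ} (hq0 : q ≠ 0) {n L : ℕ} {l A : ℤ}
    (hA : 2 * A = (n + 1) * L + l) :
    {η : Vec (n + 1) | η ∈ multIndex (n + 1) L ((l : ℚ) / 2) ∧
      multTerm q (n + 1) 0 L ((l : ℚ) / 2) η ≠ 0}.Finite := by
  refine ((multinomTerm_finite (N := n + 1) q (L : ℤ)).image
    (fun κ => ((fun c : Fin n => κ c.castSucc) : Vec (n + 1)))).subset ?_
  rintro η ⟨h1, h2⟩
  obtain ⟨κ, hκ, rfl⟩ := (init_bijOn_multIndex hA).surjOn h1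
  refine ⟨κ, ?_, rfl⟩
  simp only [multTerm_init hq0 hA hκ] at h2
  exact right_ne_zero_of_mul h2

/-! ### The (m, n)-system and string configurations. -/

lemma mnSystem_iff {N : ℕ} {l : ℤ} {i : ℕ} {m n : Vec N} :
    mnSystem N l i m n ↔ cartan N *ᵥ m = (2 * (i : ℤ) + l) • unitVec N 1 - (2 : ℤ) • n := by
  rw [mnSystem, incidence, Matrix.sub_mulVec, Matrix.smul_mulVec, Matrix.one_mulVec, smul_add]
  constructor <;> intro h
  · linear_combination h
  · linear_combination h

/-- Vacancy numbers are second-order sums of their sources. Read in reversed order, they vanish past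
the last index, while the value at full length N enters at index 1. -/
lemma cartan_mulVec_minSum {n : ℕ} (w : Fin (n + 1) → ℤ) :
    cartan (n + 1) *ᵥ (fun j : Fin n => minSum ((Fin.rev j).val + 1) w)
      = fun j : Fin n => w (Fin.rev j).castSucc + if j.val = 0 then minSum (n + 1) w else 0 := by
  refine funext fun (j : Fin n) => ?_
  have hj : j.val < n := j.isLt
  have h := cartan_mul_sum (n + 1) (fun x : ℕ => minSum (n + 1 - x) w)
    (by rw [Nat.sub_self, minSum_zero_left]) j
  have hd := minSum_second_difference w (Fin.rev (j : Fin n)).castSucc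
  rw [Fin.val_castSucc, Fin.val_rev] at hd
  rw [show n - (j.val + 1) + 2 = n + 1 - j.val by omega,
    show n - (j.val + 1) + 1 = n + 1 - (j.val + 1) by omega] at hd
  rw [show n + 1 - (j.val + 2) = n - (j.val + 1) by omega, Nat.sub_zero] at h
  have hs : (cartan (n + 1) *ᵥ (fun j : Fin n => minSum ((Fin.rev j).val + 1) w)) j
      = ∑ k : Fin (n + 1 - 1), ((cartan (n + 1) j k : ℤ) : ℤ) * minSum (n + 1 - (k.val + 1)) w := by
    rw [Matrix.mulVec, dotProduct]
    refine Finset.sum_congr rfl fun (k : Fin n) _ => ?_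
    have := k.isLt
    rw [Fin.val_rev, show n - (k.val + 1) + 1 = n + 1 - (k.val + 1) by omega]
  simp only [Int.cast_id] at h
  refine (hs.trans h).trans ?_
  linarith

/-- The weights of a configuration of strings: the number `i` of missing boxes, the vacancy numbers
`m` and the multiplicities `n`, both read from the longest strings downwards. -/
def stringData {n : ℕ} (L : ℕ) (A' : ℤ) (ν : Fin (n + 1) → ℤ) :
    ℕ × (Vec (n + 1) × Vec (n + 1)) :=
  ((A' - minSum (n + 1) ν).toNat,
    ((fun j : Fin n => minSum ((Fin.rev j).val + 1)
      ((L : ℤ) • partVec (n + 1) (n + 1) - (2 : ℤ) • ν)),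
    (fun j : Fin n => ν (Fin.rev j).castSucc)))

lemma comp_stringData {n L : ℕ} (A' : ℤ) (ν : Fin (n + 1) → ℤ) :
    comp (n + 1) 1 (stringData L A' ν).2.1
      = n * L - 2 * (minSum (n + 1) ν - ν (Fin.last n)) := by
  have h1 : comp (n + 1) 1 (stringData L A' ν).2.1
      = minSum n ((L : ℤ) • partVec (n + 1) (n + 1) - (2 : ℤ) • ν) := by
    set w := (L : ℤ) • partVec (n + 1) (n + 1) - (2 : ℤ) • ν with hw
    change ∑ j : Fin n, partVec n 1 j * minSum ((Fin.rev j).val + 1) w = _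
    rcases Nat.eq_zero_or_pos n with rfl | hn
    · simp [minSum_zero_left]
    · have h := sum_mul_partVec (N := n) (a := 1)
        (fun x => if x = 0 then 0 else minSum (n + 1 - x) w) (if_pos rfl) hn
      simp only [Nat.add_eq_zero_iff, one_ne_zero, and_false, if_false, Nat.add_sub_cancel] at h
      rw [← h]
      refine Finset.sum_congr rfl fun j _ => ?_
      have := j.isLt
      rw [Fin.val_rev, show n - (j.val + 1) + 1 = n + 1 - (j.val + 1) by omega, mul_comm]
  have h2 : minSum n ν = minSum (n + 1) ν - ν (Fin.last n) := by
    rw [minSum_init, minSum_init (n + 1), minSum_succ_top, min_self, min_eq_left (by omega)]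
    push_cast; ring
  rw [h1, map_sub, map_smul, map_smul, minSum_partVec _ le_rfl, min_eq_left (by omega), h2]
  simp only [smul_eq_mul]; ring

lemma form_unitVec_one_rev {n : ℕ} (v : Fin n → ℤ) :
    form (n + 1) (unitVec (n + 1) 1) (fun c : Fin n => v (Fin.rev c))
      = (minSum (n + 1) v : ℚ) / (n + 1) := by
  have hn : (n : ℚ) + 1 ≠ 0 := by positivity
  have h : ∑ c, v (Fin.rev c) = ∑ c, v c := Equiv.sum_comp Fin.revPerm v
  rw [form_unitVec_one, minSum_top_rev, h]
  push_cast
  field_simp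
  ring

lemma mnSystem_stringData {n L : ℕ} {l A' : ℤ} (hA' : 2 * A' = (n + 1) * L - l)
    {ν : Fin (n + 1) → ℤ} (hν : minSum (n + 1) ν ≤ A') :
    mnSystem (n + 1) l (stringData L A' ν).1 (stringData L A' ν).2.1 (stringData L A' ν).2.2 := by
  have hi : (((stringData L A' ν).1 : ℕ) : ℤ) = A' - minSum (n + 1) ν :=
    Int.toNat_of_nonneg (by omega)
  rw [mnSystem_iff, hi]
  refine (cartan_mulVec_minSum _).trans (funext fun (j : Fin n) => ?_)
  have hj : partVec (n + 1) (n + 1) (Fin.rev j).castSucc = 0 :=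
    partVec_apply_of_ne (by have := j.isLt; rw [Fin.val_castSucc, Fin.val_rev]; omega)
  have hu : unitVec (n + 1) 1 j = if j.val = 0 then 1 else 0 := by
    simp [unitVec]
  change _ = (2 * (A' - minSum (n + 1) ν) + l) * unitVec (n + 1) 1 j
    - 2 * ν (Fin.rev j).castSucc
  rw [hu, map_sub, map_smul, map_smul, minSum_partVec _ le_rfl, min_self]
  simp only [Pi.sub_apply, Pi.smul_apply, smul_eq_mul, hj]
  push_cast
  split_ifs
  · linarith
  · ring

/-- The integer z of the range condition provides the missing multiplicity ν_N = L - z; the given i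
is then the value of A' - ∑ a ν_a. -/
lemma exists_stringData {n L : ℕ} {l A' : ℤ} (hA' : 2 * A' = (n + 1) * L - l) {i : ℕ}
    {v : Vec (n + 1)} (hv : v ∈ nIndex (n + 1) L l i) :
    ∃ ν : Fin (n + 1) → ℤ, minSum (n + 1) ν ≤ A' ∧ (stringData L A' ν).1 = i
      ∧ (stringData L A' ν).2.2 = v := by
  obtain ⟨z, hz⟩ := hv
  have hn : (n : ℚ) + 1 ≠ 0 := by positivity
  have hl : (l : ℚ) = (n + 1) * L - 2 * A' := by
    have : 2 * (A' : ℚ) = (n + 1) * L - l := by exact_mod_cast hA'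
    linarith
  set u : Fin n → ℤ := fun c => v (Fin.rev c) with hu
  have hvu : v = fun c : Fin n => u (Fin.rev c) := by
    funext c
    change v c = v (Fin.rev (Fin.rev (c : Fin n)))
    rw [Fin.rev_rev]
  have hform : form (n + 1) (unitVec (n + 1) 1) v = (minSum (n + 1) u : ℚ) / (n + 1) := by
    rw [hvu]; exact form_unitVec_one_rev u
  rw [hform, hl] at hz
  have hi : (i : ℚ) = A' - (minSum (n + 1) u + (n + 1) * (L - z)) := by
    rw [← hz]
    push_cast
    field_simp
    ring
  have hi' : (i : ℤ) = A' - (minSum (n + 1) u + (n + 1) * (L - z)) := by exact_mod_cast hi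
  have hw : minSum (n + 1) (Fin.snoc (α := fun _ => ℤ) u (L - z) : Fin (n + 1) → ℤ)
      = minSum (n + 1) u + (n + 1) * (L - z) := by
    rw [minSum_init, min_self]
    simp only [Fin.snoc_castSucc, Fin.snoc_last]
    push_cast; rfl
  refine ⟨Fin.snoc (α := fun _ => ℤ) u (L - z), ?_, ?_, ?_⟩
  · rw [hw]; omega
  · change (A' - minSum (n + 1) _).toNat = i
    rw [hw]; omega
  · rw [hvu]
    funext c
    exact Fin.snoc_castSucc (α := fun _ => ℤ) (L - z : ℤ) u (Fin.rev (c : Fin n))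

lemma mnSystem_unique {N : ℕ} (hN : 1 ≤ N) {l : ℤ} {i : ℕ} {m m' v : Vec N}
    (h : mnSystem N l i m v) (h' : mnSystem N l i m' v) : m = m' :=
  cartan_mulVec_injective hN ((mnSystem_iff.mp h).trans (mnSystem_iff.mp h').symm)

lemma stringData_bijOn {n L : ℕ} {l A' : ℤ} (hA' : 2 * A' = (n + 1) * L - l) :
    Set.BijOn (stringData L A') {ν : Fin (n + 1) → ℤ | minSum (n + 1) ν ≤ A'}
      {x | x.2 ∈ mnIndex (n + 1) L l x.1} := by
  have hn : (n : ℚ) + 1 ≠ 0 := by positivity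
  refine ⟨fun ν hν => ⟨?_, mnSystem_stringData hA' hν⟩, fun ν hν ν' hν' h => ?_, fun x hx => ?_⟩
  · have hν' : minSum (n + 1) ν ≤ A' := hν
    have hi : (((stringData L A' ν).1 : ℕ) : ℤ) = A' - minSum (n + 1) ν :=
      Int.toNat_of_nonneg (by omega)
    have hiq : (((stringData L A' ν).1 : ℕ) : ℚ) = A' - minSum (n + 1) ν := by exact_mod_cast hi
    have hl : (l : ℚ) = (n + 1) * L - 2 * A' := by
      have : 2 * (A' : ℚ) = (n + 1) * L - l := by exact_mod_cast hA'
      linarith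
    refine ⟨L - ν (Fin.last n), ?_⟩
    have hf : form (n + 1) (unitVec (n + 1) 1) (stringData L A' ν).2.2
        = (minSum (n + 1) (fun c : Fin n => ν c.castSucc) : ℚ) / (n + 1) :=
      form_unitVec_one_rev fun c : Fin n => ν c.castSucc
    rw [hf, hiq, hl, minSum_init (n + 1) ν, min_self]
    push_cast
    field_simp
    ring
  · have e1 : (A' - minSum (n + 1) ν).toNat = (A' - minSum (n + 1) ν').toNat := congrArg Prod.fst h
    have e2 : minSum (n + 1) ν = minSum (n + 1) ν' := by
      have h1 : minSum (n + 1) ν ≤ A' := hν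
      have h2 : minSum (n + 1) ν' ≤ A' := hν'
      omega
    have e3 : ∀ c : Fin n, ν c.castSucc = ν' c.castSucc := by
      intro c
      have h3 : ν (Fin.rev (Fin.rev c)).castSucc = ν' (Fin.rev (Fin.rev c)).castSucc :=
        congrFun (congrArg (fun x => x.2.2) h) (Fin.rev c)
      rwa [Fin.rev_rev] at h3
    rw [minSum_init, minSum_init (n + 1) ν', funext e3, min_self] at e2
    have e4 : ν (Fin.last n) = ν' (Fin.last n) :=
      mul_left_cancel₀ (by positivity : ((n + 1 : ℕ) : ℤ) ≠ 0) (add_left_cancel e2)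
    funext c
    exact Fin.lastCases e4 e3 c
  · obtain ⟨i, m, v⟩ := x
    obtain ⟨h1, h2⟩ := hx
    obtain ⟨ν, hν, rfl, rfl⟩ := exists_stringData hA' h1
    refine ⟨ν, hν, Prod.ext rfl (Prod.ext ?_ rfl)⟩
    exact mnSystem_unique (by omega) (mnSystem_stringData hA' hν) h2

/-- Since i + ℓ = A - ∑ a ν_a, the symmetry of the q-binomial turns the bottoms i + ℓ and i into
ν_N. The squares of ∑ a ν_a divided by N cancel between q^{i(i+ℓ)/N} and q^{n C⁻¹ n}. -/
lemma decompTerm_stringData {q : ℂ} (hq0 : q ≠ 0) {n L : ℕ} {l A A' : ℤ}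
    (hA : 2 * A = (n + 1) * L + l) (hA' : 2 * A' = (n + 1) * L - l)
    {ν : Fin (n + 1) → ℤ} (hν : minSum (n + 1) ν ≤ A') :
    q ^ (((((stringData L A' ν).1 : ℚ) * ((stringData L A' ν).1 + l) / ((n + 1 : ℕ) : ℚ) : ℚ)) : ℂ)
      * decompTerm q (n + 1) L l (stringData L A' ν).1 (stringData L A' ν).2.1
        (stringData L A' ν).2.2
    = q ^ ((L * A - (A : ℚ) ^ 2 / (n + 1) : ℚ) : ℂ)
      * fermTerm q ((L : ℤ) • partVec (n + 1) (n + 1)) A ν := by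
  have hn : (n : ℚ) + 1 ≠ 0 := by positivity
  have hi : (((stringData L A' ν).1 : ℕ) : ℤ) = A' - minSum (n + 1) ν :=
    Int.toNat_of_nonneg (by omega)
  have hiq : (((stringData L A' ν).1 : ℕ) : ℚ) = A' - minSum (n + 1) ν := by exact_mod_cast hi
  have hAA : A' = (n + 1) * L - A := by linarith
  have hl : l = 2 * A - (n + 1) * L := by linarith
  have hform : form (n + 1) (stringData L A' ν).2.2 (stringData L A' ν).2.2
      = minForm ν ν - (minSum (n + 1) ν : ℚ) ^ 2 / (n + 1) :=
    (form_rev fun c : Fin n => ν c.castSucc).trans (form_init ν)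
  have hL : minForm ν ((L : ℤ) • partVec (n + 1) (n + 1)) = L * minSum (n + 1) ν := by
    rw [minForm_smul_right, minForm_partVec_right le_rfl]
  have hwL : minSum (n + 1) ((L : ℤ) • partVec (n + 1) (n + 1)) = (n + 1) * L := by
    rw [map_smul, minSum_partVec _ le_rfl, min_self, smul_eq_mul]; push_cast; ring
  have hpow : q ^ (((((stringData L A' ν).1 : ℚ) * ((stringData L A' ν).1 + l)
        / ((n + 1 : ℕ) : ℚ) : ℚ)) : ℂ)
      * q ^ ((form (n + 1) (stringData L A' ν).2.2 (stringData L A' ν).2.2 : ℚ) : ℂ)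
      = q ^ ((L * A - (A : ℚ) ^ 2 / (n + 1) : ℚ) : ℂ)
        * q ^ (minForm ν ν - L * minSum (n + 1) ν) := by
    rw [← cpow_ratCast_intCast, ← cpow_ratCast_add hq0, ← cpow_ratCast_add hq0, hform, hiq, hAA, hl]
    congr 2
    push_cast
    field_simp
    ring
  have hprod : ∏ j, qBin q ((stringData L A' ν).2.1 j + (stringData L A' ν).2.2 j)
        ((stringData L A' ν).2.2 j)
      = ∏ c : Fin n, qBin q (minSum (c.val + 1) ((L : ℤ) • partVec (n + 1) (n + 1) - (2 : ℤ) • ν)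
          + ν c.castSucc) (ν c.castSucc) :=
    Equiv.prod_comp Fin.revPerm fun c : Fin n => qBin q (minSum (c.val + 1)
      ((L : ℤ) • partVec (n + 1) (n + 1) - (2 : ℤ) • ν) + ν c.castSucc) (ν c.castSucc)
  have hb1 : qBin q ((L + l + comp (n + 1) 1 (stringData L A' ν).2.1) / 2)
      (((stringData L A' ν).1 : ℕ) + l)
      = qBin q (ν (Fin.last n) + (A - minSum (n + 1) ν)) (ν (Fin.last n)) := by
    rw [comp_stringData, hi, hl, hAA,
      show (L : ℤ) + (2 * A - (n + 1) * L) + (n * L - 2 * (minSum (n + 1) ν - ν (Fin.last n)))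
        = 2 * (ν (Fin.last n) + (A - minSum (n + 1) ν)) by ring,
      Int.mul_ediv_cancel_left _ two_ne_zero, ← qBin_symm]
    congr 1; ring
  have hb2 : qBin q ((L - l + comp (n + 1) 1 (stringData L A' ν).2.1) / 2)
      ((stringData L A' ν).1 : ℕ)
      = qBin q (ν (Fin.last n) + ((n + 1) * L - A - minSum (n + 1) ν)) (ν (Fin.last n)) := by
    rw [comp_stringData, hi, hl, hAA,
      show (L : ℤ) - (2 * A - (n + 1) * L) + (n * L - 2 * (minSum (n + 1) ν - ν (Fin.last n)))
        = 2 * (ν (Fin.last n) + ((n + 1) * L - A - minSum (n + 1) ν)) by ring,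
      Int.mul_ediv_cancel_left _ two_ne_zero, ← qBin_symm]
    congr 1; ring
  rw [decompTerm, hprod, hb1, hb2, fermTerm, hL, hwL]
  linear_combination (∏ c : Fin n, qBin q (minSum (c.val + 1)
    ((L : ℤ) • partVec (n + 1) (n + 1) - (2 : ℤ) • ν) + ν c.castSucc) (ν c.castSucc))
    * qBin q (ν (Fin.last n) + (A - minSum (n + 1) ν)) (ν (Fin.last n))
    * qBin q (ν (Fin.last n) + ((n + 1) * L - A - minSum (n + 1) ν)) (ν (Fin.last n)) * hpow

lemma decompTerm_support_finite {q : ℂ} (hq0 : q ≠ 0) {n L : ℕ} {l A A' : ℤ}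
    (hA : 2 * A = (n + 1) * L + l) (hA' : 2 * A' = (n + 1) * L - l) :
    {x : ℕ × (Vec (n + 1) × Vec (n + 1)) | x.2 ∈ mnIndex (n + 1) L l x.1 ∧
      decompTerm q (n + 1) L l x.1 x.2.1 x.2.2 ≠ 0}.Finite := by
  refine ((fermTerm_finite q ((L : ℤ) • partVec (n + 1) (n + 1)) A).image
    (stringData L A')).subset ?_
  rintro x ⟨h1, h2⟩
  obtain ⟨ν, hν, rfl⟩ := (stringData_bijOn hA').surjOn h1
  refine ⟨ν, ?_, rfl⟩
  have h := decompTerm_stringData hq0 hA hA' hν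
  intro h0
  rw [h0, mul_zero, mul_eq_zero] at h
  exact h.elim (fun h => hq0 ((Complex.cpow_eq_zero_iff _ _).mp h).1) h2

theorem decompSum_eq_fermSum {q : ℂ} (hq0 : q ≠ 0) {n L : ℕ} {l A A' : ℤ}
    (hA : 2 * A = (n + 1) * L + l) (hA' : 2 * A' = (n + 1) * L - l) :
    decompSum q (n + 1) L l = q ^ ((L * A - (A : ℚ) ^ 2 / (n + 1) : ℚ) : ℂ)
      * fermSum q ((L : ℤ) • partVec (n + 1) (n + 1)) A := by
  set X : Set (ℕ × (Vec (n + 1) × Vec (n + 1))) := {x | x.2 ∈ mnIndex (n + 1) L l x.1} with hX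
  set F : ℕ × (Vec (n + 1) × Vec (n + 1)) → ℂ := fun x =>
    q ^ ((((x.1 : ℚ) * (x.1 + l) / ((n + 1 : ℕ) : ℚ) : ℚ)) : ℂ)
      * decompTerm q (n + 1) L l x.1 x.2.1 x.2.2 with hF
  have hfin : (Function.support (X.indicator F)).Finite := by
    refine (decompTerm_support_finite hq0 hA hA').subset fun x hx => ?_
    rw [Function.mem_support, Set.indicator_apply_ne_zero] at hx
    exact ⟨hx.1, right_ne_zero_of_mul hx.2⟩
  have h1 : decompSum q (n + 1) L l = ∑ᶠ x ∈ X, F x := by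
    rw [finsum_mem_def, finsum_curry _ hfin, decompSum]
    refine finsum_congr fun i => ?_
    rw [finsum_mem_def, mul_finsum]
    refine finsum_congr fun p => ?_
    by_cases hp : p ∈ mnIndex (n + 1) L l i
    · rw [Set.indicator_of_mem hp, Set.indicator_of_mem (show (i, p) ∈ X from hp)]
    · rw [Set.indicator_of_notMem hp, Set.indicator_of_notMem (show (i, p) ∉ X from hp), mul_zero]
  rw [h1, ← finsum_mem_eq_of_bijOn (f := fun ν => q ^ ((L * A - (A : ℚ) ^ 2 / (n + 1) : ℚ) : ℂ)
    * fermTerm q ((L : ℤ) • partVec (n + 1) (n + 1)) A ν) (stringData L A') (stringData_bijOn hA')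
    fun ν hν => (decompTerm_stringData hq0 hA hA' hν).symm, finsum_mem_def, fermSum, mul_finsum,
    Set.indicator_eq_self.mpr]
  -- Configurations with ∑ a ν_a > A' do not come from any i ≥ 0, but their fermionic terms vanish.
  intro ν hν
  have h := (fermTerm_support (right_ne_zero_of_mul hν)).2.2
  rw [map_smul, minSum_partVec _ le_rfl, min_self, smul_eq_mul] at h
  push_cast at h
  change minSum (n + 1) ν ≤ A'
  linarith

theorem T_eq_decompSum {q : ℂ} (hq0 : q ≠ 0) (hq1 : ‖q‖ < 1) {n L : ℕ} {l A A' : ℤ}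
    (hA : 2 * A = (n + 1) * L + l) (hA' : 2 * A' = (n + 1) * L - l) :
    T q (n + 1) 0 L ((l : ℚ) / 2) = decompSum q (n + 1) L l := by
  rw [T_eq_nestedSum hq0 hq1 hA, decompSum_eq_fermSum hq0 hA hA', fermSum_top hq0 hq1, ← mul_assoc,
    ← cpow_ratCast_intCast, ← cpow_ratCast_add hq0]
  congr 3
  push_cast; ring

/-! ### The case N = 1. -/

lemma T_one {q : ℂ} (hq0 : q ≠ 0) (hq1 : ‖q‖ < 1) {L : ℕ} {l A A' : ℤ}
    (hA : 2 * A = L + l) (hA' : 2 * A' = L - l) :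
    T q 1 0 L ((l : ℚ) / 2) = qBin q L A' := by
  have h := T_eq_nestedSum hq0 hq1 (n := 0) (L := L) (l := l) (A := A) (by push_cast; linarith)
  rw [zero_add, nestedSum_one, ← mul_assoc, ← cpow_ratCast_intCast, ← cpow_ratCast_add hq0] at h
  rw [h, ← qBin_symm, show (L : ℤ) - A = A' by linarith]
  have : (-((A : ℚ) ^ 2 / (((0 : ℕ) : ℚ) + 1)) + ((A ^ 2 : ℤ) : ℚ) : ℚ) = 0 := by push_cast; ring
  rw [this]
  simp

lemma decompSum_one (q : ℂ) {L : ℕ} {l A A' : ℤ}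
    (hA : 2 * A = L + l) (hA' : 2 * A' = L - l) :
    decompSum q 1 L l = ∑ i ∈ Finset.range (A'.toNat + 1),
      q ^ ((i : ℤ) * (i + l)) * qBin q A (i + l) * qBin q A' i := by
  have : IsEmpty (Fin (1 - 1)) := inferInstanceAs (IsEmpty (Fin 0))
  have hpair : ∀ i : ℕ, ∀ p : Vec 1 × Vec 1, p ∈ mnIndex 1 L l i := by
    intro i p
    have hz : form 1 (unitVec 1 1) p.2 = 0 := by
      rw [form]; exact Finset.sum_of_isEmpty _
    -- For N = 1 the range condition reads (L + ℓ)/2 + i ∈ ℤ, which always holds, and there is a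
    -- single, empty pair of vectors.
    refine ⟨⟨A + i, ?_⟩, funext fun j => j.elim0⟩
    have : 2 * (A : ℚ) = L + l := by exact_mod_cast hA
    rw [hz]
    push_cast
    linarith
  have hterm : ∀ i : ℕ, q ^ ((((i : ℚ) * (i + l) / ((1 : ℕ) : ℚ) : ℚ)) : ℂ)
      * ∑ᶠ p ∈ mnIndex 1 L l i, decompTerm q 1 L l i p.1 p.2
      = q ^ ((i : ℤ) * (i + l)) * qBin q A (i + l) * qBin q A' i := by
    intro i
    have hu : mnIndex 1 L l i = Set.univ := Set.eq_univ_of_forall (hpair i)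
    have hd : ∀ p : Vec 1 × Vec 1, decompTerm q 1 L l i p.1 p.2 = qBin q A (i + l) * qBin q A' i := by
      intro p
      have hz : form 1 p.2 p.2 = 0 := by
        rw [form]; exact Finset.sum_of_isEmpty _
      have hc : comp 1 1 p.1 = 0 := by
        rw [comp]; exact Finset.sum_of_isEmpty _
      have hp : ∏ j, qBin q (p.1 j + p.2 j) (p.2 j) = 1 := Finset.prod_of_isEmpty _
      rw [decompTerm, hz, hc, hp, add_zero, add_zero, ← hA, ← hA',
        Int.mul_ediv_cancel_left _ two_ne_zero, Int.mul_ediv_cancel_left _ two_ne_zero]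
      simp
    have hUnique : ∃ p₀ : Vec 1 × Vec 1, ∀ p, p = p₀ :=
      ⟨(fun j => j.elim0, fun j => j.elim0), fun p =>
        Prod.ext (funext fun j => j.elim0) (funext fun j => j.elim0)⟩
    obtain ⟨p₀, hp₀⟩ := hUnique
    rw [hu, finsum_mem_univ, finsum_congr hd, finsum_eq_single _ p₀ fun p hp => absurd (hp₀ p) hp,
      ← mul_assoc, ← cpow_ratCast_intCast]
    congr 4
    push_cast; ring
  rw [decompSum, finsum_congr hterm, finsum_eq_sum_of_support_subset]
  intro i hi
  have := nonneg_of_qBin_ne_zero (right_ne_zero_of_mul hi)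
  simp only [Finset.coe_range, Set.mem_Iio]
  omega

end QMult

end

/-! ### The decomposition theorem. -/

theorem mainTheorem5 (q : ℂ) (hq0 : q ≠ 0) (hq1 : ‖q‖ < 1) (N L : ℕ) (hN : 1 ≤ N) (l : ℤ)
    (hl : |l| ≤ (N : ℤ) * L) (hpar : l ≡ (N : ℤ) * L [ZMOD 2]) :
    -- every admissible `n` determines an integer vector `m`, and the tops are integers
    (∀ (i : ℕ), ∀ n ∈ QMult.nIndex N L l i,
      (∃! m : QMult.Vec N, QMult.mnSystem N l i m n) ∧
      ∀ m : QMult.Vec N, QMult.mnSystem N l i m n →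
        (2 : ℤ) ∣ L + l + QMult.comp N 1 m ∧ (2 : ℤ) ∣ L - l + QMult.comp N 1 m) ∧
    -- all sums have only finitely many nonzero terms
    {η : QMult.Vec N | η ∈ QMult.multIndex N L ((l : ℚ) / 2) ∧
      QMult.multTerm q N 0 L ((l : ℚ) / 2) η ≠ 0}.Finite ∧
    {x : ℕ × (QMult.Vec N × QMult.Vec N) | x.2 ∈ QMult.mnIndex N L l x.1 ∧
      QMult.decompTerm q N L l x.1 x.2.1 x.2.2 ≠ 0}.Finite ∧
    -- the decomposition
    QMult.T q N 0 L ((l : ℚ) / 2) = QMult.decompSum q N L l ∧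
    -- for `N = 1` the two sides are those of the `q`-Chu–Vandermonde sum
    (N = 1 →
      QMult.T q N 0 L ((l : ℚ) / 2) = QMult.qBin q L ((L - l) / 2) ∧
      QMult.decompSum q N L l =
        ∑ i ∈ Finset.range (((L - l) / 2).toNat + 1),
          q ^ ((i : ℤ) * (i + l)) * QMult.qBin q ((L + l) / 2) (i + l)
            * QMult.qBin q ((L - l) / 2) i) := by
  obtain ⟨n, rfl⟩ : ∃ n, N = n + 1 := ⟨N - 1, by omega⟩
  obtain ⟨A', hA'⟩ := hpar.dvd
  push_cast at hA'
  have hA' : 2 * A' = (n + 1) * L - l := hA'.symm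
  obtain ⟨A, hA⟩ : ∃ A, 2 * A = ((n : ℤ) + 1) * L + l := ⟨A' + l, by linarith⟩
  refine ⟨fun i v hv => ?_, QMult.multTerm_support_finite hq0 hA,
    QMult.decompTerm_support_finite hq0 hA hA', QMult.T_eq_decompSum hq0 hq1 hA hA', fun h1 => ?_⟩
  -- Every admissible n comes from a string configuration, whose vacancy numbers give the integral
  -- solution m; uniqueness is the invertibility of C.
  · obtain ⟨ν, hν, rfl, rfl⟩ := QMult.exists_stringData hA' hv
    have hsys := QMult.mnSystem_stringData hA' hν
    refine ⟨⟨_, hsys, fun m hm => QMult.mnSystem_unique hN hm hsys⟩, fun m hm => ?_⟩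
    rw [QMult.mnSystem_unique hN hm hsys, QMult.comp_stringData]
    exact ⟨⟨A - (QMult.minSum (n + 1) ν - ν (Fin.last n)), by linarith⟩,
      ⟨A' - (QMult.minSum (n + 1) ν - ν (Fin.last n)), by linarith⟩⟩
  · obtain rfl : n = 0 := by omega
    have hA1 : 2 * A = (L : ℤ) + l := by push_cast at hA; linarith
    have hA1' : 2 * A' = (L : ℤ) - l := by push_cast at hA'; linarith
    rw [← hA1, ← hA1', Int.mul_ediv_cancel_left _ two_ne_zero,
      Int.mul_ediv_cancel_left _ two_ne_zero]
    exact ⟨QMult.T_one hq0 hq1 hA1 hA1', QMult.decompSum_one q hA1 hA1'⟩
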